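/- **Setting.** For $m\ge 3$ let $x=(x_1,\dots,x_m)\sim N(\boldsymbol\mu,\boldsymbol\Sigma)$, where $\boldsymbol\Sigma$ is a correlation matrix, and let $x^0\sim N(0,\boldsymbol\Sigma)$. Put $I_0=\{i:\mu_i=0\}$, $I_1=\{i:\mu_i\ne0\}$, $\pi=|I_1|/m$, and assume $\mu_i=\sqrt{2h\log m}$ for $i\in I_1$, with $h>0$. Let $\bar\Phi=1-\Phi$ be the standard normal tail, $\mathbb T=[\sqrt{\log\log m},\sqrt{5\log m}]\cap\mathbb N$ and, for a non-empty $I\subseteq\{1,\dots,m\}$, $$V^*_\theta(x^0_I)=\max_{t\in\mathbb T}\frac{\big||I|^{-1}\sum_{i\in I}1\{x^0_i>t\}-\bar\Phi(t)\big|}{\bar\Phi(t)^\theta}.$$ For bounding values $c_{m,\theta}$ let $$\hat\pi^*_\theta(x)=\max_{t\in\mathbb T}\frac{m^{-1}\sum_{i=1}^m1\{x_i>t\}-\bar\Phi(t)-c_{m,\theta}\,\bar\Phi(t)^\theta}{1-\bar\Phi(t)},\qquad \hat\pi^*(x)=\max\{\hat\pi^*_{0.5}(x),\hat\pi^*_1(x)\}.$$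 Write $V^*_{m,\theta}(x^0)$ for $V^*_\theta(x^0_I)$ with $I=\{1,\dots,m\}$. The dependence parameter $\eta\in[0,1]$ is defined by $m^{-2}\sum_{i,j}|\Sigma_{ij}|=m^{-\eta}$, and $a_+=\max(a,0)$. **1. Lower bound, explicit bounding sequences.** For every $\alpha\in(0,1)$ there are positive constants $K_{1,\alpha},K_{0.5,\alpha}$, depending only on $\alpha$, such that for all constants $C_{1}\ge K_{1,\alpha}$, $C_{0.5}\ge K_{0.5,\alpha}$ and every $\eta\in[0,1]$ the sequences $$c_{m,1}=C_{1}\sqrt{\log m},\qquad c_{m,0.5}=C_{0.5}\sqrt{m^{-\eta}\log m}$$ have the following properties: $m\,c_{m,\theta}$ is non-decreasing in $m$; and for every $m\ge3$ and every correlation matrix $\boldsymbol\Sigma$ with dependence parameter $\eta$, $P(V^*_{m,\theta}(x^0)>c_{m,\theta})<\alpha$ for $\theta=0.5$ and $\theta=1$; and, whenever $\pi=m^{-\gamma}$ with $\gamma\in(0,1)$, $$P(\hat\pi^*(x)<\pi)\ge1-\alpha .$$ **2. Lower bound, arbitrary bounding sequences.** Let $\alpha\in(0,1)$, $m\ge 3$,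 $\pi=m^{-\gamma}$ with $\gamma\in(0,1)$, and $m_0=|I_0|=m-|I_1|$. If, for $\theta=0.5$ and $\theta=1$, $m_0c_{m_0,\theta}<m\,c_{m,\theta}$ and $P(V^*_\theta(x^0_{I_0})>c_{m_0,\theta})<\alpha/2$ (with the grid $\mathbb T$ of size $m$), then $P(\hat\pi^*(x)<\pi)\ge1-\alpha$. **3. Consistency.** Let $\gamma\in(0,1)$, $\eta\in[0,1]$, $h>0$ be fixed and consider a model as above for each $m\ge3$, with $\pi=\pi_m$ satisfying $\pi_m m^{\gamma}\to1$ and $m^{-2}\sum_{i,j}|\Sigma_{ij}|=m^{-\eta}$. For every $\alpha\in(0,1)$ let $C_{1,\alpha},C_{0.5,\alpha}$ be constants, not depending on $m$, such that $c_{m,1}(\alpha)=C_{1,\alpha}\sqrt{\log m}$ and $c_{m,0.5}(\alpha)=C_{0.5,\alpha}\sqrt{m^{-\eta}\log m}$ satisfy $P(V^*_{m,\theta}(x^0)>c_{m,\theta}(\alpha))<\alpha$ for all $m\ge3$ and $\theta\in\{0.5,1\}$. Let $\alpha_m\in(0,1)$, $\alpha_m\to0$, slowly enough that for every $\delta>0$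 both $C_{1,\alpha_m}$ and $C_{0.5,\alpha_m}$ are at most $m^{\delta}$ for all large $m$, and let $\hat\pi^*$ be built with $c_{m,\theta}(\alpha_m)$. * If $h>[\gamma-(\eta-\gamma)_+]_+$, then $P((1-\epsilon)\pi_m<\hat\pi^*(x)<\pi_m)\to1$ for every $\epsilon>0$. * ("Almost only if") If $h<[\gamma-(\eta-\gamma)_+]_+$, then $\hat\pi^*(x)/\pi_m\to0$ in probability, and $P((1-\epsilon)\pi_m<\hat\pi^*(x)<\pi_m)\to0$ for every $\epsilon\in(0,1)$. -/

import Mathlib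

open MeasureTheory ProbabilityTheory Filter Topology

namespace SignalProportion

/-- Upper tail `1 - Φ` of the standard normal distribution. -/
noncomputable def gaussTail (t : ℝ) : ℝ := 1 - cdf (gaussianReal 0 1) t

/-- The grid of natural numbers in `[√(log log m), √(5 log m)]`. -/
noncomputable def grid (m : ℕ) : Finset ℕ :=
  Finset.Icc ⌈√(Real.log (Real.log m))⌉₊ ⌊√(5 * Real.log m)⌋₊

theorem grid_nonempty (m : ℕ) : (grid m).Nonempty := by
  rw [grid, Finset.nonempty_Icc]
  by_cases hL : Real.log m ≤ 1
  · have h0 : 0 ≤ Real.log m := Real.log_natCast_nonneg m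
    have h1 : Real.log (Real.log m) ≤ 0 := Real.log_nonpos h0 hL
    simp [Real.sqrt_eq_zero_of_nonpos h1]
  · push Not at hL
    have h1 : 0 ≤ Real.log (Real.log m) := Real.log_nonneg hL.le
    have h2 : Real.log (Real.log m) ≤ Real.log m - 1 :=
      Real.log_le_sub_one_of_pos (by linarith)
    have h3 : √(Real.log (Real.log m)) + 1 ≤ √(5 * Real.log m) := by
      apply Real.le_sqrt_of_sq_le
      have h4 := Real.sq_sqrt h1
      nlinarith [sq_nonneg (√(Real.log (Real.log m)) - 1)]
    exact Nat.le_floor ((Nat.ceil_lt_add_one (Real.sqrt_nonneg _)).le.trans h3)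

/-- The grid is exactly `[√(log log m), √(5 log m)] ∩ ℕ`. -/
theorem mem_grid {m t : ℕ} :
    t ∈ grid m ↔ √(Real.log (Real.log m)) ≤ t ∧ (t : ℝ) ≤ √(5 * Real.log m) := by
  rw [grid, Finset.mem_Icc, Nat.ceil_le, Nat.le_floor_iff (Real.sqrt_nonneg _)]

/-- Proportion of the coordinates `i ∈ I` with `x i > t`. -/
noncomputable def exceedFrac {m : ℕ} (I : Finset (Fin m)) (x : EuclideanSpace ℝ (Fin m))
    (t : ℝ) : ℝ :=
  (I.card : ℝ)⁻¹ * ∑ i ∈ I, if t < x i then (1 : ℝ) else 0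

/-- The discretized null statistic `V*_θ` of the subvector `(x i)_{i ∈ I}`:
maximum over the grid of `|exceedance fraction - tail| / tail ^ θ`. -/
noncomputable def nullStat {m : ℕ} (θ : ℝ) (I : Finset (Fin m))
    (x : EuclideanSpace ℝ (Fin m)) : ℝ :=
  (grid m).sup' (grid_nonempty m) fun t =>
    |exceedFrac I x t - gaussTail t| / gaussTail t ^ θ

/-- The discretized estimator `π̂*_θ` with bounding value `c`. -/
noncomputable def piHatTheta {m : ℕ} (θ c : ℝ) (x : EuclideanSpace ℝ (Fin m)) : ℝ :=
  (grid m).sup' (grid_nonempty m) fun t =>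
    (exceedFrac Finset.univ x t - gaussTail t - c * gaussTail t ^ θ) / (1 - gaussTail t)

/-- The discretized adaptive estimator `max {π̂*_{1/2}, π̂*_1}`, with bounding value `cHalf`
for `θ = 1/2` and `cOne` for `θ = 1`. -/
noncomputable def piHat {m : ℕ} (cHalf cOne : ℝ) (x : EuclideanSpace ℝ (Fin m)) : ℝ :=
  max (piHatTheta (1 / 2) cHalf x) (piHatTheta 1 cOne x)

/-- Bounding sequence `C √(log m)` used for `θ = 1`. -/
noncomputable def boundOne (C : ℝ) (m : ℕ) : ℝ := C * √(Real.log m)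

/-- Bounding sequence `C √(m ^ (-η) log m)` used for `θ = 1/2`. -/
noncomputable def boundHalf (C η : ℝ) (m : ℕ) : ℝ := C * √((m : ℝ) ^ (-η) * Real.log m)

/-- `S` is a correlation matrix. -/
def IsCorrelation {m : ℕ} (S : Matrix (Fin m) (Fin m) ℝ) : Prop :=
  S.PosSemidef ∧ ∀ i, S i i = 1

/-- The average of the `|S i j|` is `m ^ (-η)`. -/
def DependenceCalib {m : ℕ} (S : Matrix (Fin m) (Fin m) ℝ) (η : ℝ) : Prop :=
  ((m : ℝ) ^ 2)⁻¹ * ∑ i, ∑ j, |S i j| = (m : ℝ) ^ (-η)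

/-- Every nonzero mean equals `√(2 h log m)`. -/
def MeanCalib {m : ℕ} (μ : EuclideanSpace ℝ (Fin m)) (h : ℝ) : Prop :=
  ∀ i, μ i ≠ 0 → μ i = √(2 * h * Real.log m)

/-- Indices of the noise variables. -/
noncomputable def noiseSet {m : ℕ} (μ : EuclideanSpace ℝ (Fin m)) : Finset (Fin m) :=
  Finset.univ.filter fun i => μ i = 0

/-- Indices of the signal variables. -/
noncomputable def signalSet {m : ℕ} (μ : EuclideanSpace ℝ (Fin m)) : Finset (Fin m) :=
  Finset.univ.filter fun i => μ i ≠ 0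

/-- The signal proportion `|I₁| / m`. -/
noncomputable def signalProp {m : ℕ} (μ : EuclideanSpace ℝ (Fin m)) : ℝ :=
  ((signalSet μ).card : ℝ) / m

end SignalProportion

/-!
The estimator compares exceedance fractions with the normal tail `gaussTail t = 1 - Φ(t)` on a grid
of levels. Everything rests on splitting the centred exceedance fraction into noise and signal,
`F(t) - gaussTail t = centredAvg noise t + π (F₁(t) - gaussTail t)`, where `F₁` is the exceedance
fraction among the signals (`exceedFrac_univ_sub`). Since `F₁ ≤ 1`, the estimator stays below `π` as
long as the noise term stays below the bounding sequence at every grid point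
(`piHatTheta_lt_signalProp`). This reduces the lower bound property to deviation bounds for the
noise.

For `θ = 1` the deviation bound is Markov's inequality (`measureReal_boundOne_le`). For `θ = 1/2` it
is Chebyshev's inequality (`measureReal_boundHalf_le`), and the dependence parameter enters through
the covariance of two exceedance indicators: for standard Gaussians with correlation `ρ` and
`t ≥ 1` this covariance is at most a constant times `|ρ| t gaussTail t`
(`abs_measureReal_exceed_sub_sq_le`). For small `ρ` one conditions on one of the variables and uses
that `gaussTail` is Lipschitz; for large `ρ` the bound is trivial. The superfluous factor
`t ≤ √(5 log m)` and the `O(√(log m))` grid points of the union bound are together absorbed by the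
factor `log m` in the squared bounding sequence. Both bounds hold for any subset of coordinates with
mean zero, with constants independent of the subset, so they apply to the null vector and to its
noise coordinates alike.

For consistency, the constants `C(α)` are only assumed to control the null vector, but they must
diverge as `α → 0` (`eventually_le_constant`): the top grid points are so high that a single
exceedance there beats any fixed constant for suitable `m`. Hence the noise is asymptotically below
the bounding sequences, even below half of them. If `h` is above the boundary, choose `r` a little
below `min h (5/2)`: at `t ≈ √(2 r log m)` almost all signals exceed `t`, while one of the two bounding
sequences is negligible relative to `π`, the one for `θ = 1` when `r > γ` and the one for `θ = 1/2`
when `r > 2 γ - η`. If `h` is below the boundary, choose `r` slightly above `h`: up to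
`√(2 r log m)` both bounding sequences exceed `π`, and beyond it hardly any signal is left, so no
grid point can make the estimator as large as `ε π`.
-/

namespace SignalProportion

/-! ### The standard normal tail -/

theorem gaussTail_eq_measureReal (t : ℝ) : gaussTail t = (gaussianReal 0 1).real (Set.Ioi t) := by
  rw [gaussTail, cdf_eq_real, ← Set.compl_Iic, probReal_compl_eq_one_sub measurableSet_Iic]

theorem gaussTail_eq_integral (t : ℝ) :
    gaussTail t = ∫ x in Set.Ioi t, gaussianPDFReal 0 1 x := by
  rw [gaussTail_eq_measureReal, measureReal_def, gaussianReal_apply_eq_integral _ one_ne_zero,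
    ENNReal.toReal_ofReal (integral_nonneg fun x => gaussianPDFReal_nonneg _ _ _)]

theorem gaussTail_nonneg (t : ℝ) : 0 ≤ gaussTail t := by
  rw [gaussTail_eq_measureReal]; exact measureReal_nonneg

theorem gaussTail_le_one (t : ℝ) : gaussTail t ≤ 1 := by
  rw [gaussTail_eq_measureReal]; exact measureReal_le_one

theorem gaussTail_antitone : Antitone gaussTail := fun _ _ h =>
  sub_le_sub_left (monotone_cdf _ h) _

theorem tendsto_gaussTail_atTop : Tendsto gaussTail atTop (𝓝 0) := by
  simpa [← gaussTail.eq_1] using (tendsto_cdf_atTop (gaussianReal 0 1)).const_sub 1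

theorem tendsto_gaussTail_atBot : Tendsto gaussTail atBot (𝓝 1) := by
  simpa [← gaussTail.eq_1] using (tendsto_cdf_atBot (gaussianReal 0 1)).const_sub 1

theorem gaussTail_eq_add_intervalIntegral (a b : ℝ) :
    gaussTail a = gaussTail b + ∫ x in a..b, gaussianPDFReal 0 1 x := by
  have hint := integrable_gaussianPDFReal 0 1
  rw [gaussTail_eq_integral, gaussTail_eq_integral, add_comm,
    intervalIntegral.integral_interval_add_Ioi hint.integrableOn hint.integrableOn]

theorem pdf_zero_one (x : ℝ) :
    gaussianPDFReal 0 1 x = (√(2 * Real.pi))⁻¹ * Real.exp (-x ^ 2 / 2) := by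
  simp [gaussianPDFReal_def]

theorem inv_sqrt_two_pi_le : (√(2 * Real.pi))⁻¹ ≤ 1 / 2 := by
  have h : (2 : ℝ) ≤ √(2 * Real.pi) := by
    apply Real.le_sqrt_of_sq_le
    linarith [Real.pi_gt_three]
  rw [one_div]
  exact inv_anti₀ two_pos h

theorem pdf_le_exp (x : ℝ) : gaussianPDFReal 0 1 x ≤ 1 / 2 * Real.exp (-x ^ 2 / 2) := by
  rw [pdf_zero_one]
  exact mul_le_mul_of_nonneg_right inv_sqrt_two_pi_le (Real.exp_nonneg _)

theorem pdf_le_one (x : ℝ) : gaussianPDFReal 0 1 x ≤ 1 := by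
  have h : Real.exp (-x ^ 2 / 2) ≤ 1 := Real.exp_le_one_iff.2 (by nlinarith [sq_nonneg x])
  linarith [pdf_le_exp x]

theorem abs_gaussTail_sub_le (a b : ℝ) : |gaussTail a - gaussTail b| ≤ |a - b| := by
  rw [gaussTail_eq_add_intervalIntegral a b, add_sub_cancel_left]
  have h := intervalIntegral.norm_integral_le_of_norm_le_const (a := a) (b := b) (C := 1)
    (f := gaussianPDFReal 0 1) (fun x _ => by
      rw [Real.norm_of_nonneg (gaussianPDFReal_nonneg _ _ _)]; exact pdf_le_one x)
  rw [one_mul, abs_sub_comm] at h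
  exact h

theorem hasDerivAt_neg_pdf (x : ℝ) :
    HasDerivAt (fun y => -gaussianPDFReal 0 1 y) (x * gaussianPDFReal 0 1 x) x := by
  have h1 : HasDerivAt (fun y : ℝ => -y ^ 2 / 2) (-x) x := by
    refine ((hasDerivAt_pow 2 x).neg.div_const 2).congr_deriv ?_
    push_cast
    ring
  have h2 := ((h1.exp).const_mul (√(2 * Real.pi))⁻¹).neg
  simp only [pdf_zero_one]
  exact h2.congr_deriv (by ring)

theorem tendsto_neg_pdf_atTop : Tendsto (fun y => -gaussianPDFReal 0 1 y) atTop (𝓝 0) := by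
  have h1 : Tendsto (fun y : ℝ => -y ^ 2 / 2) atTop atBot := by
    have h := (tendsto_pow_atTop (α := ℝ) two_ne_zero).atTop_div_const two_pos
    simpa [neg_div, Function.comp_def] using tendsto_neg_atTop_atBot.comp h
  have h2 := ((Real.tendsto_exp_atBot.comp h1).const_mul (√(2 * Real.pi))⁻¹).neg
  simpa [pdf_zero_one, Function.comp_def] using h2

theorem integrableOn_mul_pdf {t : ℝ} (ht : 0 ≤ t) :
    IntegrableOn (fun x => x * gaussianPDFReal 0 1 x) (Set.Ioi t) :=
  integrableOn_Ioi_deriv_of_nonneg' (fun x _ => hasDerivAt_neg_pdf x)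
    (fun _ hx => mul_nonneg (ht.trans (le_of_lt hx)) (gaussianPDFReal_nonneg _ _ _))
    tendsto_neg_pdf_atTop

theorem integral_Ioi_mul_pdf {t : ℝ} (ht : 0 ≤ t) :
    ∫ x in Set.Ioi t, x * gaussianPDFReal 0 1 x = gaussianPDFReal 0 1 t := by
  rw [integral_Ioi_of_hasDerivAt_of_tendsto' (fun x _ => hasDerivAt_neg_pdf x)
    (integrableOn_mul_pdf ht) tendsto_neg_pdf_atTop]
  simp

theorem setIntegral_gaussianReal (f : ℝ → ℝ) {s : Set ℝ} (hs : MeasurableSet s) :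
    ∫ x in s, f x ∂gaussianReal 0 1 = ∫ x in s, gaussianPDFReal 0 1 x * f x := by
  rw [← integral_indicator hs, integral_gaussianReal_eq_integral_smul one_ne_zero,
    ← integral_indicator hs]
  congr 1
  ext x
  by_cases hx : x ∈ s <;> simp [hx]

theorem gaussTail_le_pdf {t : ℝ} (ht : 1 ≤ t) : gaussTail t ≤ gaussianPDFReal 0 1 t := by
  rw [← integral_Ioi_mul_pdf (by linarith), gaussTail_eq_integral]
  refine setIntegral_mono_on (integrable_gaussianPDFReal 0 1).integrableOn
    (integrableOn_mul_pdf (by linarith)) measurableSet_Ioi fun x hx => ?_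
  exact le_mul_of_one_le_left (gaussianPDFReal_nonneg _ _ _) (ht.trans (le_of_lt hx))

theorem gaussTail_le_exp {t : ℝ} (ht : 1 ≤ t) : gaussTail t ≤ 1 / 2 * Real.exp (-t ^ 2 / 2) :=
  (gaussTail_le_pdf ht).trans (pdf_le_exp t)

theorem gaussTail_le_half {t : ℝ} (ht : 1 ≤ t) : gaussTail t ≤ 1 / 2 := by
  have h : Real.exp (-t ^ 2 / 2) ≤ 1 := Real.exp_le_one_iff.2 (by nlinarith [sq_nonneg t])
  linarith [gaussTail_le_exp ht]

/-- Mills-type lower bound, from the mass of `[t, t + 1/t]` alone. -/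
theorem pdf_le_mul_gaussTail {t : ℝ} (ht : 1 ≤ t) :
    gaussianPDFReal 0 1 t ≤ 5 * (t * gaussTail t) := by
  have ht0 : 0 < t := by linarith
  have hinv : 1 / t ≤ 1 := by rw [div_le_one ht0]; exact ht
  have hinv0 : 0 < 1 / t := by positivity
  have h1 : ∀ x ∈ Set.Icc t (t + 1 / t), gaussianPDFReal 0 1 t / 5 ≤ gaussianPDFReal 0 1 x := by
    intro x hx
    have hx2 : x ^ 2 ≤ t ^ 2 + 3 := by
      have : x ^ 2 ≤ (t + 1 / t) ^ 2 := pow_le_pow_left₀ (by linarith [hx.1]) hx.2 2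
      have h2 : (t + 1 / t) ^ 2 = t ^ 2 + 2 + (1 / t) ^ 2 := by field_simp; ring
      nlinarith
    -- the density drops by at most `exp (3/2) < 5` over the interval
    have h5 : Real.exp (3 / 2) ≤ 5 := by
      have h3 : Real.exp (3 / 2) ^ 2 ≤ 5 ^ 2 := by
        rw [← Real.exp_nat_mul]
        have : Real.exp (((2 : ℕ) : ℝ) * (3 / 2)) = Real.exp 1 ^ 3 := by
          rw [← Real.exp_nat_mul]; norm_num
        rw [this]
        have he := Real.exp_one_lt_d9
        calc Real.exp 1 ^ 3 ≤ 2.7182818286 ^ 3 :=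
              pow_le_pow_left₀ (Real.exp_nonneg _) he.le 3
          _ ≤ 5 ^ 2 := by norm_num
      exact le_of_sq_le_sq h3 (by norm_num)
    have h6 : Real.exp (-t ^ 2 / 2) ≤ 5 * Real.exp (-x ^ 2 / 2) := by
      calc Real.exp (-t ^ 2 / 2) ≤ Real.exp (3 / 2 + -x ^ 2 / 2) := Real.exp_le_exp.2 (by linarith)
        _ = Real.exp (3 / 2) * Real.exp (-x ^ 2 / 2) := Real.exp_add _ _
        _ ≤ _ := mul_le_mul_of_nonneg_right h5 (Real.exp_nonneg _)
    rw [pdf_zero_one, pdf_zero_one, mul_div_assoc]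
    exact mul_le_mul_of_nonneg_left (by linarith) (by positivity)
  have h2 : gaussianPDFReal 0 1 t / 5 * (1 / t) ≤ ∫ x in t..(t + 1 / t), gaussianPDFReal 0 1 x := by
    have := intervalIntegral.integral_mono_on (a := t) (b := t + 1 / t) (μ := volume)
      (f := fun _ => gaussianPDFReal 0 1 t / 5) (g := gaussianPDFReal 0 1) (by linarith)
      (by simp) (integrable_gaussianPDFReal 0 1).intervalIntegrable h1
    rw [intervalIntegral.integral_const, smul_eq_mul] at this
    linarith
  have h3 : gaussianPDFReal 0 1 t / 5 * (1 / t) ≤ gaussTail t := by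
    rw [gaussTail_eq_add_intervalIntegral t (t + 1 / t)]
    linarith [gaussTail_nonneg (t + 1 / t)]
  rw [mul_one_div, div_div, div_le_iff₀ (by positivity)] at h3
  linarith

theorem gaussTail_pos (t : ℝ) : 0 < gaussTail t := by
  set s := max t 1
  have hs : 1 ≤ s := le_max_right _ _
  have h := (gaussianPDFReal_pos 0 1 s one_ne_zero).trans_le (pdf_le_mul_gaussTail hs)
  have hs0 : 0 < gaussTail s := by
    by_contra h0
    have : gaussTail s = 0 := le_antisymm (not_lt.1 h0) (gaussTail_nonneg s)
    rw [this] at h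
    simp at h
  exact hs0.trans_le (gaussTail_antitone (le_max_left _ _))

theorem gaussTail_rpow_le_half {t θ : ℝ} (hθ : 1 / 2 ≤ θ) :
    gaussTail t ^ θ ≤ gaussTail t ^ (1 / 2 : ℝ) :=
  Real.rpow_le_rpow_of_exponent_ge (gaussTail_pos _) (gaussTail_le_one _) hθ

theorem exp_le_mul_gaussTail {t : ℝ} (ht : 1 ≤ t) :
    Real.exp (-t ^ 2 / 2) ≤ 15 * (t * gaussTail t) := by
  have h := pdf_le_mul_gaussTail ht
  rw [pdf_zero_one] at h
  have h2 : √(2 * Real.pi) ≤ 3 := by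
    rw [Real.sqrt_le_left (by norm_num)]
    linarith [Real.pi_lt_four]
  have h3 : (1 : ℝ) / 3 ≤ (√(2 * Real.pi))⁻¹ := by
    rw [one_div]; exact inv_anti₀ (by positivity) h2
  nlinarith [mul_le_mul_of_nonneg_right h3 (Real.exp_nonneg (-t ^ 2 / 2))]

/-! ### Covariance of two Gaussian exceedance indicators -/

/-- A covariance bound for exceedance indicators at small correlation `ρ`. Writing
`Y = ρ X + √(1 - ρ²) Z` with `Z` independent of `X`, the conditional probability of `Y > t` given
`X` differs from `gaussTail t` by a multiple of `|ρ|`, since `gaussTail` is Lipschitz. -/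
theorem abs_measureReal_exceed_sub_sq_le_of_small {Ω : Type*} [MeasurableSpace Ω] {P : Measure Ω}
    {X Y : Ω → ℝ} {ρ t : ℝ} (hXY : HasGaussianLaw (fun ω => (X ω, Y ω)) P)
    (hX : P.map X = gaussianReal 0 1) (hY : P.map Y = gaussianReal 0 1)
    (hmX : Measurable X) (hmY : Measurable Y)
    (hcov : cov[X, Y; P] = ρ) (hρ : |ρ| ≤ 1 / 2) (ht : 1 ≤ t) :
    |P.real {ω | t < X ω ∧ t < Y ω} - gaussTail t ^ 2| ≤ 3 * |ρ| * gaussianPDFReal 0 1 t := by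
  have hP := hXY.isProbabilityMeasure
  have hρ2 : ρ ^ 2 ≤ 1 / 4 := by
    have := abs_le.1 hρ
    nlinarith
  set σ := √(1 - ρ ^ 2) with hσ
  have hσsq : σ ^ 2 = 1 - ρ ^ 2 := Real.sq_sqrt (by linarith)
  have hσ0 : 1 / 2 ≤ σ := Real.le_sqrt_of_sq_le (by linarith)
  have hσ1 : σ ≤ 1 := Real.sqrt_le_one.2 (by nlinarith [sq_nonneg ρ])
  have hσpos : 0 < σ := by linarith
  have hXm := hXY.fst.memLp_two
  have hYm := hXY.snd.memLp_two
  have hvarX : Var[X; P] = 1 := by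
    have := variance_map (X := id) (μ := P) (Y := X) (by fun_prop) (by fun_prop)
    rw [hX, variance_id_gaussianReal] at this
    simpa using this.symm
  have hvarY : Var[Y; P] = 1 := by
    have := variance_map (X := id) (μ := P) (Y := Y) (by fun_prop) (by fun_prop)
    rw [hY, variance_id_gaussianReal] at this
    simpa using this.symm
  have hEX : ∫ ω, X ω ∂P = 0 := by
    have := integral_map (μ := P) (φ := X) (f := id) (by fun_prop) (by fun_prop)
    rw [hX] at this
    simpa using this.symm
  have hEY : ∫ ω, Y ω ∂P = 0 := by
    have := integral_map (μ := P) (φ := Y) (f := id) (by fun_prop) (by fun_prop)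
    rw [hY] at this
    simpa using this.symm
  -- the standardized residual of `Y` given `X`
  set Z : Ω → ℝ := fun ω => σ⁻¹ * (Y ω - ρ * X ω) with hZ
  have hmZ : Measurable Z := by fun_prop
  have hXZ : HasGaussianLaw (fun ω => (X ω, Z ω)) P :=
    hXY.map_fun ((ContinuousLinearMap.fst ℝ ℝ ℝ).prod
      (σ⁻¹ • (ContinuousLinearMap.snd ℝ ℝ ℝ - ρ • ContinuousLinearMap.fst ℝ ℝ ℝ)))
  have hρXm : MemLp (fun ω => ρ * X ω) 2 P := hXm.const_mul ρ
  have hcovXZ : cov[X, Z; P] = 0 := by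
    rw [hZ, covariance_const_mul_right, covariance_fun_sub_right hXm hYm hρXm,
      covariance_const_mul_right, covariance_self hmX.aemeasurable, hvarX, hcov]
    simp
  have hind : IndepFun X Z P := hXZ.indepFun_of_covariance_eq_zero hcovXZ
  have hEZ : ∫ ω, Z ω ∂P = 0 := by
    rw [hZ, integral_const_mul, integral_sub hXY.snd.integrable
      (hXY.fst.integrable.const_mul ρ), integral_const_mul, hEX, hEY]
    simp
  have hvarZ : Var[Z; P] = 1 := by
    rw [hZ, variance_const_mul, variance_fun_sub hYm hρXm, variance_const_mul,
      covariance_const_mul_right, covariance_comm, hcov, hvarX, hvarY]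
    have : (1 + ρ ^ 2 * 1 - 2 * (ρ * ρ)) = σ ^ 2 := by rw [hσsq]; ring
    field_simp
    linarith
  have hZlaw : P.map Z = gaussianReal 0 1 := by
    rw [hXZ.snd.map_eq_gaussianReal, hEZ, hvarZ]
    simp
  have hprod : P.map (fun ω => (X ω, Z ω)) = (gaussianReal 0 1).prod (gaussianReal 0 1) := by
    rw [(indepFun_iff_map_prod_eq_prod_map_map hmX.aemeasurable hmZ.aemeasurable).1 hind,
      hX, hZlaw]
  set f : ℝ → ℝ := fun x => gaussTail ((t - ρ * x) / σ) with hf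
  have hfm : Measurable f := by
    have := gaussTail_antitone.measurable
    fun_prop
  have hfint : Integrable f (gaussianReal 0 1) := by
    refine Integrable.of_bound hfm.aestronglyMeasurable 1 (Eventually.of_forall fun x => ?_)
    rw [Real.norm_of_nonneg (gaussTail_nonneg _)]
    exact gaussTail_le_one _
  have hjoint : P.real {ω | t < X ω ∧ t < Y ω} =
      ∫ x in Set.Ioi t, f x ∂gaussianReal 0 1 := by
    set A : Set (ℝ × ℝ) := {p | t < p.1 ∧ t < ρ * p.1 + σ * p.2} with hA
    have hAm : MeasurableSet A :=
      (measurableSet_lt measurable_const measurable_fst).inter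
        (measurableSet_lt measurable_const
          (by fun_prop : Measurable fun p : ℝ × ℝ => ρ * p.1 + σ * p.2))
    have h1 : {ω | t < X ω ∧ t < Y ω} = (fun ω => (X ω, Z ω)) ⁻¹' A := by
      ext ω
      have : ρ * X ω + σ * Z ω = Y ω := by simp only [hZ]; field_simp; ring
      simp [hA, this]
    rw [h1, ← map_measureReal_apply (hmX.prodMk hmZ) hAm, hprod, measureReal_def,
      Measure.prod_apply hAm, ← integral_indicator measurableSet_Ioi]
    rw [integral_eq_lintegral_of_nonneg_ae
      (Eventually.of_forall fun x => Set.indicator_nonneg (fun _ _ => gaussTail_nonneg _) x)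
      ((hfm.indicator measurableSet_Ioi).aestronglyMeasurable)]
    congr 1
    refine lintegral_congr fun x => ?_
    by_cases hx : t < x
    · have h2 : Prod.mk x ⁻¹' A = Set.Ioi ((t - ρ * x) / σ) := by
        ext z
        simp only [hA, Set.mem_preimage, Set.mem_ofPred_eq, hx, true_and, Set.mem_Ioi,
          div_lt_iff₀ hσpos]
        constructor <;> intro h <;> linarith
      rw [h2, Set.indicator_of_mem (by exact hx)]
      simp only [gaussTail_eq_measureReal]
      exact (ENNReal.ofReal_toReal (measure_ne_top _ _)).symm
    · have h2 : Prod.mk x ⁻¹' A = ∅ := by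
        ext z
        simp [hA, hx]
      rw [h2, Set.indicator_of_notMem (by exact hx)]
      simp
  have hsq : gaussTail t ^ 2 = ∫ x in Set.Ioi t, gaussTail t ∂gaussianReal 0 1 := by
    rw [setIntegral_const, ← gaussTail_eq_measureReal, smul_eq_mul, sq]
  rw [hjoint, hsq, ← integral_sub hfint.integrableOn (integrable_const _).integrableOn]
  have hbound : ∀ x, t < x → |f x - gaussTail t| ≤ 3 * |ρ| * x := by
    intro x hx
    have h1 := abs_gaussTail_sub_le ((t - ρ * x) / σ) t
    have hx0 : 0 < x := by linarith
    have h2 : (t - ρ * x) / σ - t = (t * (1 - σ) - ρ * x) / σ := by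
      field_simp
      ring
    have h3 : |t * (1 - σ) - ρ * x| ≤ t * (|ρ| / 2) + |ρ| * x := by
      refine (abs_sub _ _).trans ?_
      rw [abs_mul, abs_mul, abs_of_nonneg (by linarith : (0 : ℝ) ≤ t),
        abs_of_nonneg (by linarith : 0 ≤ 1 - σ), abs_of_pos hx0]
      have : 1 - σ ≤ |ρ| / 2 := by
        have h4 : 1 - σ ≤ ρ ^ 2 := by nlinarith
        have h5 : ρ ^ 2 ≤ |ρ| / 2 := by rw [← sq_abs]; nlinarith [abs_nonneg ρ]
        linarith
      nlinarith
    refine h1.trans ?_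
    rw [h2, abs_div, abs_of_pos hσpos, div_le_iff₀ hσpos]
    refine h3.trans ?_
    have h6 : 0 ≤ |ρ| * x := by positivity
    nlinarith [mul_le_mul_of_nonneg_left hx.le (abs_nonneg ρ)]
  have hxint : Integrable (fun x => 3 * |ρ| * x) (gaussianReal 0 1) :=
    (IsGaussian.integrable_fun_id).const_mul _
  rw [← Real.norm_eq_abs]
  refine (norm_integral_le_integral_norm _).trans ?_
  calc ∫ x in Set.Ioi t, ‖f x - gaussTail t‖ ∂gaussianReal 0 1
      ≤ ∫ x in Set.Ioi t, 3 * |ρ| * x ∂gaussianReal 0 1 :=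
        setIntegral_mono_on ((hfint.sub (integrable_const _)).norm.integrableOn)
          hxint.integrableOn measurableSet_Ioi fun x hx => hbound x hx
    _ = 3 * |ρ| * gaussianPDFReal 0 1 t := by
        rw [integral_const_mul, setIntegral_gaussianReal _ measurableSet_Ioi]
        congr 1
        rw [← integral_Ioi_mul_pdf (by linarith)]
        simp only [mul_comm]

theorem abs_measureReal_exceed_sub_sq_le {Ω : Type*} [MeasurableSpace Ω] {P : Measure Ω}
    {X Y : Ω → ℝ} {ρ t : ℝ} (hXY : HasGaussianLaw (fun ω => (X ω, Y ω)) P)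
    (hX : P.map X = gaussianReal 0 1) (hY : P.map Y = gaussianReal 0 1)
    (hmX : Measurable X) (hmY : Measurable Y)
    (hcov : cov[X, Y; P] = ρ) (ht : 1 ≤ t) :
    |P.real {ω | t < X ω ∧ t < Y ω} - gaussTail t ^ 2| ≤ 15 * |ρ| * (t * gaussTail t) := by
  by_cases hρ : |ρ| ≤ 1 / 2
  · refine (abs_measureReal_exceed_sub_sq_le_of_small hXY hX hY hmX hmY hcov hρ ht).trans ?_
    have := mul_le_mul_of_nonneg_left (pdf_le_mul_gaussTail ht)
      (by positivity : 0 ≤ 3 * |ρ|)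
    linarith
  · have hP := hXY.isProbabilityMeasure
    have hT := gaussTail_nonneg t
    have hT1 := gaussTail_le_one t
    have h1 : P.real {ω | t < X ω ∧ t < Y ω} ≤ gaussTail t := by
      rw [gaussTail_eq_measureReal, ← hX, map_measureReal_apply hmX measurableSet_Ioi]
      exact measureReal_mono fun ω h => h.1
    have h0 : 0 ≤ P.real {ω | t < X ω ∧ t < Y ω} := measureReal_nonneg
    push Not at hρ
    have h2 : gaussTail t ≤ 15 * |ρ| * (t * gaussTail t) := by
      have : 1 ≤ 15 * |ρ| * t := by nlinarith
      nlinarith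
    rw [abs_le]
    constructor <;> nlinarith

/-! ### The grid -/

theorem one_lt_log_of_three_le {m : ℕ} (hm : 3 ≤ m) : 1 < Real.log m := by
  rw [Real.lt_log_iff_exp_lt (by positivity)]
  have : (3 : ℝ) ≤ m := by exact_mod_cast hm
  linarith [Real.exp_one_lt_three]

theorem one_le_of_mem_grid {m t : ℕ} (hm : 3 ≤ m) (ht : t ∈ grid m) : (1 : ℝ) ≤ t := by
  have h1 := Real.sqrt_pos.2 (Real.log_pos (one_lt_log_of_three_le hm))
  have h2 : (0 : ℝ) < t := h1.trans_le (mem_grid.1 ht).1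
  exact_mod_cast h2

theorem card_grid_le {m : ℕ} (hm : 3 ≤ m) : ((grid m).card : ℝ) ≤ √(5 * Real.log m) := by
  have hsub : grid m ⊆ Finset.Icc 1 ⌊√(5 * Real.log m)⌋₊ := fun t ht => by
    refine Finset.mem_Icc.2 ⟨by exact_mod_cast one_le_of_mem_grid hm ht, ?_⟩
    exact Nat.le_floor (mem_grid.1 ht).2
  have h := Finset.card_le_card hsub
  rw [Nat.card_Icc, Nat.add_sub_cancel] at h
  exact (Nat.le_floor_iff (Real.sqrt_nonneg _)).1 h

/-! ### Centred exceedance averages -/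

/-- The average over all `m` coordinates of the centred exceedance indicators
`1 {x i > t} - gaussTail t`, with only the terms `i ∈ I` kept. The normalization is by `m`, not by
the size of `I`. -/
noncomputable def centredAvg {m : ℕ} (I : Finset (Fin m)) (t : ℝ)
    (x : EuclideanSpace ℝ (Fin m)) : ℝ :=
  (m : ℝ)⁻¹ * ∑ i ∈ I, ((if t < x i then (1 : ℝ) else 0) - gaussTail t)

theorem centredAvg_eq {m : ℕ} (I : Finset (Fin m)) (t : ℝ) (x : EuclideanSpace ℝ (Fin m)) :
    centredAvg I t x = (I.card : ℝ) / m * (exceedFrac I x t - gaussTail t) := by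
  rw [centredAvg, exceedFrac, Finset.sum_sub_distrib, Finset.sum_const, nsmul_eq_mul]
  rcases eq_or_ne (I.card : ℝ) 0 with h | h
  · have : I = ∅ := by simpa using h
    simp [this]
  · field_simp

theorem centredAvg_univ {m : ℕ} (hm : m ≠ 0) (t : ℝ) (x : EuclideanSpace ℝ (Fin m)) :
    centredAvg Finset.univ t x = exceedFrac Finset.univ x t - gaussTail t := by
  rw [centredAvg_eq, Finset.card_univ, Fintype.card_fin, div_self (by exact_mod_cast hm), one_mul]

section Moments

variable {m : ℕ} {μ : EuclideanSpace ℝ (Fin m)} {S : Matrix (Fin m) (Fin m) ℝ}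

theorem map_eval_multivariateGaussian (hS : IsCorrelation S) (i : Fin m) :
    (multivariateGaussian μ S).map (fun x => x i) = gaussianReal (μ i) 1 := by
  rw [(measurePreserving_eval_multivariateGaussian hS.1).map_eq, hS.2 i, Real.toNNReal_one]

theorem measurableSet_exceed (t : ℝ) (i : Fin m) :
    MeasurableSet {x : EuclideanSpace ℝ (Fin m) | t < x i} :=
  measurableSet_lt measurable_const (by fun_prop)

theorem measureReal_exceed (hS : IsCorrelation S) (t : ℝ) (i : Fin m) :
    (multivariateGaussian μ S).real {x | t < x i} = gaussTail (t - μ i) := by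
  have h1 : (multivariateGaussian μ S).real {x | t < x i} =
      (gaussianReal (μ i) 1).real (Set.Ioi t) := by
    rw [← map_eval_multivariateGaussian hS i, map_measureReal_apply (by fun_prop) measurableSet_Ioi]
    rfl
  have h2 := gaussianReal_map_add_const (μ := 0) (v := 1) (μ i)
  rw [zero_add] at h2
  rw [h1, gaussTail_eq_measureReal, ← h2,
    map_measureReal_apply (by fun_prop) measurableSet_Ioi]
  congr 1
  ext z
  simp [sub_lt_iff_lt_add]

theorem ite_eq_indicator_exceed (t : ℝ) (i : Fin m) (x : EuclideanSpace ℝ (Fin m)) :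
    (if t < x i then (1 : ℝ) else 0) =
      Set.indicator {x : EuclideanSpace ℝ (Fin m) | t < x i} 1 x := by
  by_cases h : t < x i <;> simp [h]

theorem integrable_exceed (t : ℝ) (i : Fin m) :
    Integrable (fun x => if t < x i then (1 : ℝ) else 0) (multivariateGaussian μ S) := by
  simp_rw [ite_eq_indicator_exceed]
  exact (integrable_const (1 : ℝ)).indicator (measurableSet_exceed t i)

theorem integral_exceed (hS : IsCorrelation S) (t : ℝ) (i : Fin m) :
    ∫ x, (if t < x i then (1 : ℝ) else 0) ∂multivariateGaussian μ S = gaussTail (t - μ i) := by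
  simp_rw [ite_eq_indicator_exceed]
  rw [integral_indicator_one (measurableSet_exceed t i), measureReal_exceed hS]

theorem integrable_exceed_mul (t : ℝ) (i j : Fin m) :
    Integrable (fun x => (if t < x i then (1 : ℝ) else 0) * (if t < x j then (1 : ℝ) else 0))
      (multivariateGaussian μ S) := by
  have h : ∀ x : EuclideanSpace ℝ (Fin m),
      (if t < x i then (1 : ℝ) else 0) * (if t < x j then (1 : ℝ) else 0) =
        Set.indicator ({x | t < x i} ∩ {x | t < x j}) 1 x := fun x => by
    by_cases hi : t < x i <;> by_cases hj : t < x j <;> simp [hi, hj]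
  simp_rw [h]
  exact (integrable_const (1 : ℝ)).indicator
    ((measurableSet_exceed t i).inter (measurableSet_exceed t j))

theorem integral_exceed_mul (t : ℝ) (i j : Fin m) :
    ∫ x, (if t < x i then (1 : ℝ) else 0) * (if t < x j then (1 : ℝ) else 0)
      ∂multivariateGaussian μ S =
      (multivariateGaussian μ S).real {x | t < x i ∧ t < x j} := by
  have h : ∀ x : EuclideanSpace ℝ (Fin m),
      (if t < x i then (1 : ℝ) else 0) * (if t < x j then (1 : ℝ) else 0) =
        Set.indicator {x | t < x i ∧ t < x j} 1 x := fun x => by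
    by_cases hi : t < x i <;> by_cases hj : t < x j <;> simp [hi, hj]
  simp_rw [h]
  exact integral_indicator_one ((measurableSet_exceed t i).inter (measurableSet_exceed t j))

theorem integrable_centred_mul (t : ℝ) (i j : Fin m) :
    Integrable (fun x => ((if t < x i then (1 : ℝ) else 0) - gaussTail t) *
      ((if t < x j then (1 : ℝ) else 0) - gaussTail t)) (multivariateGaussian μ S) := by
  have h := (((integrable_exceed_mul (μ := μ) (S := S) t i j).sub
    ((integrable_exceed t i).mul_const (gaussTail t))).sub
      ((integrable_exceed t j).mul_const (gaussTail t))).add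
        (integrable_const (gaussTail t ^ 2))
  refine h.congr (Eventually.of_forall fun x => ?_)
  simp only [Pi.add_apply, Pi.sub_apply]
  ring

theorem abs_integral_centred_mul_le (hS : IsCorrelation S) {t : ℝ} (ht : 1 ≤ t) {i j : Fin m}
    (hi : μ i = 0) (hj : μ j = 0) :
    |∫ x, ((if t < x i then (1 : ℝ) else 0) - gaussTail t) *
      ((if t < x j then (1 : ℝ) else 0) - gaussTail t) ∂multivariateGaussian μ S| ≤
      15 * |S i j| * (t * gaussTail t) := by
  have hint : ∫ x, ((if t < x i then (1 : ℝ) else 0) - gaussTail t) *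
      ((if t < x j then (1 : ℝ) else 0) - gaussTail t) ∂multivariateGaussian μ S =
      (multivariateGaussian μ S).real {x | t < x i ∧ t < x j} - gaussTail t ^ 2 := by
    have h : ∀ x : EuclideanSpace ℝ (Fin m), ((if t < x i then (1 : ℝ) else 0) - gaussTail t) *
      ((if t < x j then (1 : ℝ) else 0) - gaussTail t) =
      ((if t < x i then (1 : ℝ) else 0) * (if t < x j then (1 : ℝ) else 0) -
        (if t < x i then (1 : ℝ) else 0) * gaussTail t -
        (if t < x j then (1 : ℝ) else 0) * gaussTail t) + gaussTail t ^ 2 := fun x => by ring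
    have hi1 := (integrable_exceed (μ := μ) (S := S) t i).mul_const (gaussTail t)
    have hj1 := (integrable_exceed (μ := μ) (S := S) t j).mul_const (gaussTail t)
    have hij := integrable_exceed_mul (μ := μ) (S := S) t i j
    simp_rw [h]
    have hs1 := hij.sub hi1
    have hs2 := hs1.sub hj1
    simp only [Pi.sub_def] at hs1 hs2
    rw [integral_add hs2 (integrable_const _),
      integral_sub hs1 hj1, integral_sub hij hi1, integral_mul_const,
      integral_mul_const, integral_exceed hS, integral_exceed hS, integral_exceed_mul, hi, hj,
      sub_zero, integral_const]
    simp
    ring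
  rw [hint]
  refine abs_measureReal_exceed_sub_sq_le
    (P := multivariateGaussian μ S) (X := fun x => x i) (Y := fun x => x j)
    ?_ ?_ ?_ (by fun_prop) (by fun_prop) (covariance_eval_multivariateGaussian hS.1 i j) ht
  · exact (IsGaussian.hasGaussianLaw_id (μ := multivariateGaussian μ S)).map_fun
      ((EuclideanSpace.proj i : EuclideanSpace ℝ (Fin m) →L[ℝ] ℝ).prod (EuclideanSpace.proj j))
  · rw [map_eval_multivariateGaussian hS, hi]
  · rw [map_eval_multivariateGaussian hS, hj]

theorem centredAvg_sq (I : Finset (Fin m)) (t : ℝ) (x : EuclideanSpace ℝ (Fin m)) :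
    centredAvg I t x ^ 2 = ((m : ℝ) ^ 2)⁻¹ * ∑ i ∈ I, ∑ j ∈ I,
      ((if t < x i then (1 : ℝ) else 0) - gaussTail t) *
        ((if t < x j then (1 : ℝ) else 0) - gaussTail t) := by
  rw [centredAvg, mul_pow, inv_pow, sq (∑ i ∈ I, _), Finset.sum_mul_sum]

theorem integrable_centredAvg_sq (I : Finset (Fin m)) (t : ℝ) :
    Integrable (fun x => centredAvg I t x ^ 2) (multivariateGaussian μ S) := by
  simp_rw [centredAvg_sq]
  exact (integrable_finsetSum _ fun i _ => integrable_finsetSum _ fun j _ =>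
    integrable_centred_mul t i j).const_mul _

theorem integrable_centredAvg (I : Finset (Fin m)) (t : ℝ) :
    Integrable (fun x => centredAvg I t x) (multivariateGaussian μ S) :=
  (integrable_finsetSum _ fun i _ =>
    (integrable_exceed t i).sub (integrable_const _)).const_mul _

/-- The second moment of the centred average is controlled by the average absolute correlation. -/
theorem integral_centredAvg_sq_le {η : ℝ} (hS : IsCorrelation S) (hη : DependenceCalib S η)
    {I : Finset (Fin m)} (hI : ∀ i ∈ I, μ i = 0) {t : ℝ} (ht : 1 ≤ t) :
    ∫ x, centredAvg I t x ^ 2 ∂multivariateGaussian μ S ≤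
      15 * (m : ℝ) ^ (-η) * (t * gaussTail t) := by
  have hT : 0 ≤ t * gaussTail t := mul_nonneg (by linarith) (gaussTail_nonneg t)
  simp_rw [centredAvg_sq]
  rw [integral_const_mul, integral_finsetSum _ fun i _ =>
    integrable_finsetSum _ fun j _ => integrable_centred_mul t i j]
  calc _ ≤ ((m : ℝ) ^ 2)⁻¹ * ∑ i ∈ I, ∑ j ∈ I, 15 * |S i j| * (t * gaussTail t) := by
        refine mul_le_mul_of_nonneg_left (Finset.sum_le_sum fun i hi => ?_) (by positivity)
        rw [integral_finsetSum _ fun j _ => integrable_centred_mul t i j]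
        exact Finset.sum_le_sum fun j hj =>
          (le_abs_self _).trans (abs_integral_centred_mul_le hS ht (hI i hi) (hI j hj))
    _ ≤ ((m : ℝ) ^ 2)⁻¹ * ∑ i, ∑ j, 15 * |S i j| * (t * gaussTail t) := by
        refine mul_le_mul_of_nonneg_left ?_ (by positivity)
        refine (Finset.sum_le_sum fun i _ => Finset.sum_le_univ_sum_of_nonneg
          fun j => by positivity).trans (Finset.sum_le_univ_sum_of_nonneg fun i =>
            Finset.sum_nonneg fun j _ => by positivity)
    _ = 15 * (((m : ℝ) ^ 2)⁻¹ * ∑ i, ∑ j, |S i j|) * (t * gaussTail t) := by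
        simp_rw [mul_assoc, ← Finset.mul_sum, ← mul_assoc, ← Finset.sum_mul]
        ring
    _ = _ := by rw [hη]

theorem integral_abs_centredAvg_le (hS : IsCorrelation S)
    {I : Finset (Fin m)} (hI : ∀ i ∈ I, μ i = 0) (t : ℝ) :
    ∫ x, |centredAvg I t x| ∂multivariateGaussian μ S ≤ 2 * gaussTail t := by
  have hT := gaussTail_nonneg t
  have hle : ∀ x : EuclideanSpace ℝ (Fin m), |centredAvg I t x| ≤
      (m : ℝ)⁻¹ * ∑ i ∈ I, ((if t < x i then (1 : ℝ) else 0) + gaussTail t) := fun x => by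
    rw [centredAvg, abs_mul, abs_of_nonneg (by positivity : 0 ≤ (m : ℝ)⁻¹)]
    refine mul_le_mul_of_nonneg_left ((Finset.abs_sum_le_sum_abs _ _).trans
      (Finset.sum_le_sum fun i _ => ?_)) (by positivity)
    refine (abs_sub _ _).trans_eq ?_
    rw [abs_of_nonneg hT, abs_of_nonneg (by split_ifs <;> norm_num)]
  have hint : ∀ i ∈ I, Integrable (fun x => (if t < x i then (1 : ℝ) else 0) + gaussTail t)
      (multivariateGaussian μ S) := fun i _ => (integrable_exceed t i).add (integrable_const _)
  calc _ ≤ ∫ x, (m : ℝ)⁻¹ * ∑ i ∈ I, ((if t < x i then (1 : ℝ) else 0) + gaussTail t)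
        ∂multivariateGaussian μ S :=
        integral_mono (integrable_centredAvg I t).abs
          ((integrable_finsetSum _ hint).const_mul _) hle
    _ = (m : ℝ)⁻¹ * ∑ i ∈ I, 2 * gaussTail t := by
        rw [integral_const_mul, integral_finsetSum _ hint]
        congr 1
        refine Finset.sum_congr rfl fun i hi => ?_
        rw [integral_add (integrable_exceed t i) (integrable_const _), integral_exceed hS, hI i hi,
          sub_zero, integral_const]
        simp
        ring
    _ ≤ _ := by
        rw [Finset.sum_const, nsmul_eq_mul, ← mul_assoc]
        refine mul_le_of_le_one_left (by positivity) ?_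
        have h : (I.card : ℝ) ≤ m := by
          exact_mod_cast (Finset.card_le_univ I).trans_eq (Fintype.card_fin m)
        exact inv_mul_le_one_of_le₀ h (by positivity)

/-! ### Uniform deviation bounds over the grid -/

theorem measureReal_exists_mem_grid_le (P : Measure (EuclideanSpace ℝ (Fin m)))
    [IsFiniteMeasure P] (p : ℕ → EuclideanSpace ℝ (Fin m) → Prop) {b : ℝ}
    (h : ∀ t ∈ grid m, P.real {x | p t x} ≤ b) :
    P.real {x | ∃ t ∈ grid m, p t x} ≤ (grid m).card * b := by
  have : {x | ∃ t ∈ grid m, p t x} = ⋃ t ∈ grid m, {x | p t x} := by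
    ext x; simp
  rw [this, ← nsmul_eq_mul]
  exact (measureReal_biUnion_finset_le _ _).trans (Finset.sum_le_card_nsmul _ _ _ h)

/-- Markov's inequality on each grid point: the noise does not exceed the bounding sequence for
`θ = 1`, up to probability `O(1 / C)`. -/
theorem measureReal_boundOne_le (hm : 3 ≤ m) (hS : IsCorrelation S)
    {I : Finset (Fin m)} (hI : ∀ i ∈ I, μ i = 0) {C : ℝ} (hC : 0 < C) :
    (multivariateGaussian μ S).real
      {x | ∃ t ∈ grid m, boundOne C m * gaussTail t ^ (1 : ℝ) ≤ |centredAvg I t x|} ≤ 6 / C := by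
  have hL := one_lt_log_of_three_le hm
  have hL0 : 0 < √(Real.log m) := Real.sqrt_pos.2 (by linarith)
  refine (measureReal_exists_mem_grid_le _
    (fun t x => boundOne C m * gaussTail t ^ (1 : ℝ) ≤ |centredAvg I t x|)
    (b := 2 / (C * √(Real.log m))) fun t _ => ?_).trans ?_
  · have hT := gaussTail_pos t
    have hM := mul_meas_ge_le_integral_of_nonneg
      (Eventually.of_forall fun x => abs_nonneg (centredAvg I t x))
      (integrable_centredAvg (μ := μ) (S := S) I t).abs (boundOne C m * gaussTail t ^ (1 : ℝ))
    have hM2 := hM.trans (integral_abs_centredAvg_le hS hI t)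
    rw [boundOne, Real.rpow_one] at *
    rw [le_div_iff₀ (by positivity)]
    nlinarith
  · have hcard := card_grid_le hm
    rw [Real.sqrt_mul (by norm_num)] at hcard
    have h5 : √5 ≤ 3 := by rw [Real.sqrt_le_left (by norm_num)]; norm_num
    rw [mul_div_assoc', div_le_div_iff₀ (by positivity) hC]
    have : ((grid m).card : ℝ) ≤ 3 * √(Real.log m) :=
      hcard.trans (mul_le_mul_of_nonneg_right h5 hL0.le)
    nlinarith [mul_le_mul_of_nonneg_left this hC.le]

/-- Chebyshev's inequality on each grid point: the noise does not exceed the bounding sequence for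
`θ = 1 / 2`, up to probability `O(1 / C ^ 2)`. -/
theorem measureReal_boundHalf_le {η : ℝ} (hm : 3 ≤ m) (hS : IsCorrelation S)
    (hη : DependenceCalib S η) {I : Finset (Fin m)} (hI : ∀ i ∈ I, μ i = 0) {C : ℝ} (hC : 0 < C) :
    (multivariateGaussian μ S).real
      {x | ∃ t ∈ grid m, boundHalf C η m * gaussTail t ^ (1 / 2 : ℝ) ≤ |centredAvg I t x|} ≤
      75 / C ^ 2 := by
  have hL := one_lt_log_of_three_le hm
  have hm0 : (0 : ℝ) < (m : ℝ) ^ (-η) := Real.rpow_pos_of_pos (by positivity) _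
  have hcard := card_grid_le hm
  set R := √(5 * Real.log m) with hR
  have hRsq : R ^ 2 = 5 * Real.log m := Real.sq_sqrt (by linarith)
  have hR0 : 0 ≤ R := Real.sqrt_nonneg _
  refine (measureReal_exists_mem_grid_le _
    (fun t x => boundHalf C η m * gaussTail t ^ (1 / 2 : ℝ) ≤ |centredAvg I t x|)
    (b := 15 * R / (C ^ 2 * Real.log m)) fun t ht => ?_).trans ?_
  · have hT := gaussTail_pos t
    have ht1 := one_le_of_mem_grid hm ht
    have htR : (t : ℝ) ≤ R := (mem_grid.1 ht).2
    set c := boundHalf C η m * gaussTail t ^ (1 / 2 : ℝ) with hc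
    have hc0 : 0 ≤ c := by rw [hc, boundHalf]; positivity
    have hcsq : c ^ 2 = C ^ 2 * ((m : ℝ) ^ (-η) * Real.log m) * gaussTail t := by
      rw [hc, boundHalf, mul_pow, mul_pow, Real.sq_sqrt (by positivity), ← Real.sqrt_eq_rpow,
        Real.sq_sqrt hT.le]
    have hM := mul_meas_ge_le_integral_of_nonneg
      (Eventually.of_forall fun x => sq_nonneg (centredAvg I t x))
      (integrable_centredAvg_sq (μ := μ) (S := S) I t) (c ^ 2)
    have hM2 := hM.trans (integral_centredAvg_sq_le hS hη hI ht1)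
    have hset : {x : EuclideanSpace ℝ (Fin m) | c ≤ |centredAvg I t x|} =
        {x | c ^ 2 ≤ centredAvg I t x ^ 2} := by
      ext x
      rw [Set.mem_ofPred_eq, Set.mem_ofPred_eq, ← sq_abs (centredAvg I t x),
        pow_le_pow_iff_left₀ hc0 (abs_nonneg _) two_ne_zero]
    rw [hset, le_div_iff₀ (by positivity)]
    rw [hcsq] at hM2 ⊢
    set p := (multivariateGaussian μ S).real
      {x | C ^ 2 * ((m : ℝ) ^ (-η) * Real.log m) * gaussTail t ≤ centredAvg I t x ^ 2}
    have h3 : (p * (C ^ 2 * Real.log m)) * ((m : ℝ) ^ (-η) * gaussTail t) ≤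
        (15 * t) * ((m : ℝ) ^ (-η) * gaussTail t) := by linarith
    have h4 := le_of_mul_le_mul_right h3 (by positivity)
    linarith
  · rw [mul_div_assoc', div_le_div_iff₀ (by positivity) (by positivity)]
    have : ((grid m).card : ℝ) * R ≤ 5 * Real.log m := by
      rw [← hRsq, sq]; exact mul_le_mul_of_nonneg_right hcard hR0
    nlinarith [mul_le_mul_of_nonneg_right this (by positivity : 0 ≤ C ^ 2)]

end Moments

/-! ### Lower bound property -/

section LowerBound

variable {m : ℕ} {μ : EuclideanSpace ℝ (Fin m)} {S : Matrix (Fin m) (Fin m) ℝ}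

theorem eq_zero_of_mem_noiseSet {i : Fin m} (hi : i ∈ noiseSet μ) : μ i = 0 :=
  (Finset.mem_filter.1 hi).2

theorem centredAvg_noise_add_signal (t : ℝ) (x : EuclideanSpace ℝ (Fin m)) :
    centredAvg (noiseSet μ) t x + centredAvg (signalSet μ) t x = centredAvg Finset.univ t x := by
  rw [centredAvg, centredAvg, centredAvg, ← mul_add, noiseSet, signalSet,
    Finset.sum_filter_add_sum_filter_not]

theorem centredAvg_signal_eq (t : ℝ) (x : EuclideanSpace ℝ (Fin m)) :
    centredAvg (signalSet μ) t x =
      signalProp μ * (exceedFrac (signalSet μ) x t - gaussTail t) :=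
  centredAvg_eq _ _ _

theorem exceedFrac_nonneg (I : Finset (Fin m)) (x : EuclideanSpace ℝ (Fin m)) (t : ℝ) :
    0 ≤ exceedFrac I x t :=
  mul_nonneg (by positivity) (Finset.sum_nonneg fun i _ => by split_ifs <;> norm_num)

theorem exceedFrac_le_one (I : Finset (Fin m)) (x : EuclideanSpace ℝ (Fin m)) (t : ℝ) :
    exceedFrac I x t ≤ 1 := by
  have h : ∑ i ∈ I, (if t < x i then (1 : ℝ) else 0) ≤ I.card := by
    simpa using Finset.sum_le_card_nsmul I (fun i => if t < x i then (1 : ℝ) else 0) 1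
      fun i _ => by split_ifs <;> norm_num
  exact inv_mul_le_one_of_le₀ h (by positivity)

theorem exceedFrac_antitone (I : Finset (Fin m)) (x : EuclideanSpace ℝ (Fin m)) :
    Antitone (exceedFrac I x) := fun s t hst =>
  mul_le_mul_of_nonneg_left (Finset.sum_le_sum fun i _ => by
    by_cases h : t < x i
    · simp [h, hst.trans_lt h]
    · rw [if_neg h]; split_ifs <;> norm_num) (by positivity)

theorem signalProp_nonneg : 0 ≤ signalProp μ := by
  rw [signalProp]; positivity

/-- The numerator of `π̂_θ` in terms of noise and signal. -/
theorem exceedFrac_univ_sub (hm : 3 ≤ m) (t : ℝ) (x : EuclideanSpace ℝ (Fin m)) :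
    exceedFrac Finset.univ x t - gaussTail t = centredAvg (noiseSet μ) t x +
      signalProp μ * (exceedFrac (signalSet μ) x t - gaussTail t) := by
  rw [← centredAvg_univ (by omega), ← centredAvg_noise_add_signal (μ := μ), centredAvg_signal_eq]

/-- `π̂_θ` stays below the signal proportion as long as the noise stays below the bounding
sequence: even if all signals exceed every grid point, they contribute at most
`π (1 - gaussTail t)`. -/
theorem piHatTheta_lt_signalProp (hm : 3 ≤ m) {θ c : ℝ} {x : EuclideanSpace ℝ (Fin m)}
    (h : ∀ t ∈ grid m, centredAvg (noiseSet μ) t x < c * gaussTail t ^ θ) :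
    piHatTheta θ c x < signalProp μ := by
  rw [piHatTheta, Finset.sup'_lt_iff]
  intro t ht
  have hT := gaussTail_le_half (one_le_of_mem_grid hm ht)
  rw [div_lt_iff₀ (by linarith), exceedFrac_univ_sub (μ := μ) hm]
  have h1 := exceedFrac_le_one (signalSet μ) x t
  nlinarith [h t ht, mul_le_mul_of_nonneg_left h1 (signalProp_nonneg (μ := μ))]

theorem exists_mem_grid_of_lt_nullStat {θ c : ℝ} {I : Finset (Fin m)}
    {x : EuclideanSpace ℝ (Fin m)} (h : c < nullStat θ I x) :
    ∃ t ∈ grid m, c * gaussTail t ^ θ < |exceedFrac I x t - gaussTail t| := by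
  obtain ⟨t, ht, h1⟩ := (Finset.lt_sup'_iff _).1 h
  exact ⟨t, ht, (lt_div_iff₀ (Real.rpow_pos_of_pos (gaussTail_pos t) θ)).1 h1⟩

theorem nullStat_le_iff {θ c : ℝ} {I : Finset (Fin m)} {x : EuclideanSpace ℝ (Fin m)} :
    nullStat θ I x ≤ c ↔ ∀ t ∈ grid m, |exceedFrac I x t - gaussTail t| ≤ c * gaussTail t ^ θ := by
  rw [nullStat, Finset.sup'_le_iff]
  exact forall₂_congr fun t _ => div_le_iff₀ (Real.rpow_pos_of_pos (gaussTail_pos t) θ)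

theorem one_sub_le_measureReal {Ω : Type*} [MeasurableSpace Ω] (P : Measure Ω)
    [IsProbabilityMeasure P] {A B C : Set Ω} (h : ∀ x, x ∉ B → x ∉ C → x ∈ A) :
    1 - (P.real B + P.real C) ≤ P.real A := by
  have h1 : (Set.univ : Set Ω) ⊆ A ∪ (B ∪ C) := fun x _ => by
    by_contra hx
    simp only [Set.mem_union, not_or] at hx
    exact hx.1 (h x hx.2.1 hx.2.2)
  have h2 : P.real Set.univ ≤ P.real (A ∪ (B ∪ C)) := measureReal_mono h1
  have h3 := measureReal_union_le (μ := P) A (B ∪ C)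
  have h4 := measureReal_union_le (μ := P) B C
  rw [probReal_univ] at h2
  linarith

theorem piHat_lt_signalProp (hm : 3 ≤ m) {cHalf cOne : ℝ} {x : EuclideanSpace ℝ (Fin m)}
    (h1 : ¬ ∃ t ∈ grid m, cHalf * gaussTail t ^ (1 / 2 : ℝ) ≤ |centredAvg (noiseSet μ) t x|)
    (h2 : ¬ ∃ t ∈ grid m, cOne * gaussTail t ^ (1 : ℝ) ≤ |centredAvg (noiseSet μ) t x|) :
    piHat cHalf cOne x < signalProp μ := by
  push Not at h1 h2
  exact max_lt (piHatTheta_lt_signalProp hm fun t ht => (le_abs_self _).trans_lt (h1 t ht))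
    (piHatTheta_lt_signalProp hm fun t ht => (le_abs_self _).trans_lt (h2 t ht))

theorem measureReal_boundOne_lt_nullStat_le (hm : 3 ≤ m) (hS : IsCorrelation S) {C : ℝ}
    (hC : 0 < C) :
    (multivariateGaussian 0 S).real {x | boundOne C m < nullStat 1 Finset.univ x} ≤ 6 / C := by
  refine le_trans (measureReal_mono fun x hx => ?_)
    (measureReal_boundOne_le (μ := 0) hm hS (I := Finset.univ) (fun i _ => rfl) hC)
  obtain ⟨t, ht, h⟩ := exists_mem_grid_of_lt_nullStat hx
  exact ⟨t, ht, by rw [centredAvg_univ (by omega)]; exact h.le⟩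

theorem measureReal_boundHalf_lt_nullStat_le {η : ℝ} (hm : 3 ≤ m) (hS : IsCorrelation S)
    (hη : DependenceCalib S η) {C : ℝ} (hC : 0 < C) :
    (multivariateGaussian 0 S).real {x | boundHalf C η m < nullStat (1 / 2) Finset.univ x} ≤
      75 / C ^ 2 := by
  refine le_trans (measureReal_mono fun x hx => ?_)
    (measureReal_boundHalf_le (μ := 0) hm hS hη (I := Finset.univ) (fun i _ => rfl) hC)
  obtain ⟨t, ht, h⟩ := exists_mem_grid_of_lt_nullStat hx
  exact ⟨t, ht, by rw [centredAvg_univ (by omega)]; exact h.le⟩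

theorem multivariateGaussian_real_eq_preimage_add (A : Set (EuclideanSpace ℝ (Fin m))) :
    (multivariateGaussian μ S).real A =
      (multivariateGaussian 0 S).real ((fun x => μ + x) ⁻¹' A) := by
  have h : multivariateGaussian μ S =
      (multivariateGaussian 0 S).map (MeasurableEquiv.addLeft μ) := by
    rw [multivariateGaussian, multivariateGaussian, Measure.map_map (by fun_prop) (by fun_prop)]
    congr 1
    ext x
    simp
  rw [measureReal_def, measureReal_def, h, MeasurableEquiv.map_apply]
  rfl

theorem nullStat_noiseSet_add (θ : ℝ) (x : EuclideanSpace ℝ (Fin m)) :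
    nullStat θ (noiseSet μ) (μ + x) = nullStat θ (noiseSet μ) x := by
  have h : ∀ t, exceedFrac (noiseSet μ) (μ + x) t = exceedFrac (noiseSet μ) x t := fun t => by
    rw [exceedFrac, exceedFrac]
    congr 1
    refine Finset.sum_congr rfl fun i hi => ?_
    simp [eq_zero_of_mem_noiseSet hi]
  simp only [nullStat, h]

theorem centredAvg_noise_lt_of_nullStat_le {θ c c' : ℝ} (hm : 3 ≤ m)
    (hc : ((noiseSet μ).card : ℝ) * c < m * c') {x : EuclideanSpace ℝ (Fin m)}
    (hx : nullStat θ (noiseSet μ) x ≤ c) {t : ℕ} (ht : t ∈ grid m) :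
    centredAvg (noiseSet μ) t x < c' * gaussTail t ^ θ := by
  have hm0 : (0 : ℝ) < m := by positivity
  have h1 := (le_abs_self _).trans (nullStat_le_iff.1 hx t ht)
  have hT := Real.rpow_pos_of_pos (gaussTail_pos t) θ
  rw [centredAvg_eq]
  calc ((noiseSet μ).card : ℝ) / m * (exceedFrac (noiseSet μ) x t - gaussTail t)
      ≤ ((noiseSet μ).card : ℝ) / m * (c * gaussTail t ^ θ) :=
        mul_le_mul_of_nonneg_left h1 (by positivity)
    _ = ((noiseSet μ).card : ℝ) * c / m * gaussTail t ^ θ := by ring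
    _ < c' * gaussTail t ^ θ := by
        refine mul_lt_mul_of_pos_right ?_ hT
        rw [div_lt_iff₀ hm0]
        linarith

theorem one_sub_le_measureReal_piHat_lt_of_nullStat (hm : 3 ≤ m) {a : ℝ}
    {bHalf bOne cHalf cOne : ℝ}
    (hHalf : ((noiseSet μ).card : ℝ) * bHalf < m * cHalf)
    (hOne : ((noiseSet μ).card : ℝ) * bOne < m * cOne)
    (hpHalf : (multivariateGaussian 0 S).real
      {x | bHalf < nullStat (1 / 2) (noiseSet μ) x} < a / 2)
    (hpOne : (multivariateGaussian 0 S).real {x | bOne < nullStat 1 (noiseSet μ) x} < a / 2) :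
    1 - a ≤ (multivariateGaussian μ S).real {x | piHat cHalf cOne x < signalProp μ} := by
  rw [multivariateGaussian_real_eq_preimage_add]
  refine le_trans ?_ (one_sub_le_measureReal (multivariateGaussian 0 S)
    (B := {x | bHalf < nullStat (1 / 2) (noiseSet μ) x})
    (C := {x | bOne < nullStat 1 (noiseSet μ) x}) fun x h1 h2 => ?_)
  · linarith
  · simp only [Set.mem_ofPred_eq, not_lt] at h1 h2
    rw [← nullStat_noiseSet_add] at h1 h2
    exact max_lt (piHatTheta_lt_signalProp hm fun t ht =>
        centredAvg_noise_lt_of_nullStat_le hm hHalf h1 ht)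
      (piHatTheta_lt_signalProp hm fun t ht => centredAvg_noise_lt_of_nullStat_le hm hOne h2 ht)

theorem one_sub_le_measureReal_piHat_lt {η : ℝ} (hm : 3 ≤ m) (hS : IsCorrelation S)
    (hη : DependenceCalib S η) {CHalf COne : ℝ} (hHalf : 0 < CHalf) (hOne : 0 < COne) :
    1 - (75 / CHalf ^ 2 + 6 / COne) ≤ (multivariateGaussian μ S).real
      {x | piHat (boundHalf CHalf η m) (boundOne COne m) x < signalProp μ} := by
  have h1 := measureReal_boundHalf_le (μ := μ) hm hS hη
    (I := noiseSet μ) (fun i => eq_zero_of_mem_noiseSet) hHalf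
  have h2 := measureReal_boundOne_le (μ := μ) hm hS
    (I := noiseSet μ) (fun i => eq_zero_of_mem_noiseSet) hOne
  exact (sub_le_sub_left (add_le_add h1 h2) 1).trans
    (one_sub_le_measureReal _ fun x h1 h2 => piHat_lt_signalProp hm h1 h2)

end LowerBound

theorem monotone_mul_boundOne {C : ℝ} (hC : 0 ≤ C) :
    Monotone (fun k : ℕ => (k : ℝ) * boundOne C k) := by
  intro k l hkl
  simp only [boundOne]
  rcases Nat.eq_zero_or_pos k with rfl | hk
  · simp only [Nat.cast_zero, zero_mul]
    positivity
  · have hk0 : (0 : ℝ) < k := by exact_mod_cast hk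
    have hkl' : (k : ℝ) ≤ l := by exact_mod_cast hkl
    have := Real.sqrt_le_sqrt (Real.log_le_log hk0 hkl')
    gcongr

theorem monotone_mul_boundHalf {C η : ℝ} (hC : 0 ≤ C) (hη : η ≤ 1) :
    Monotone (fun k : ℕ => (k : ℝ) * boundHalf C η k) := by
  intro k l hkl
  rcases Nat.eq_zero_or_pos k with rfl | hk
  · simp only [Nat.cast_zero, zero_mul, boundHalf]
    positivity
  · have hkl' : (k : ℝ) ≤ l := by exact_mod_cast hkl
    have key : ∀ n : ℕ, 0 < n →
        (n : ℝ) * boundHalf C η n = C * √((n : ℝ) ^ (2 - η) * Real.log n) := by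
      intro n hn
      have hn0 : (0 : ℝ) < n := by exact_mod_cast hn
      have h2 : (n : ℝ) ^ (2 - η) = (n : ℝ) ^ 2 * (n : ℝ) ^ (-η) := by
        rw [← Real.rpow_natCast, ← Real.rpow_add hn0]
        norm_num [sub_eq_add_neg]
      rw [h2, mul_assoc, Real.sqrt_mul (by positivity), Real.sqrt_sq hn0.le, boundHalf]
      ring
    have hk0 : (0 : ℝ) < k := by exact_mod_cast hk
    have hlog := Real.log_le_log hk0 hkl'
    have hlogk := Real.log_natCast_nonneg k
    simp only [key k hk, key l (hk.trans_le hkl)]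
    have h2 : 0 ≤ 2 - η := by linarith
    have := Real.rpow_le_rpow hk0.le hkl' h2
    gcongr

/-! ### Growth rates along the grid -/

theorem tendsto_log_natCast : Tendsto (fun m : ℕ => Real.log m) atTop atTop :=
  Real.tendsto_log_atTop.comp tendsto_natCast_atTop_atTop

theorem tendsto_sqrt_log_natCast : Tendsto (fun m : ℕ => √(Real.log m)) atTop atTop :=
  Real.tendsto_sqrt_atTop.comp tendsto_log_natCast

theorem tendsto_natCast_rpow_neg {p : ℝ} (hp : 0 < p) :
    Tendsto (fun m : ℕ => (m : ℝ) ^ (-p)) atTop (𝓝 0) :=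
  (tendsto_rpow_neg_atTop hp).comp tendsto_natCast_atTop_atTop

theorem tendsto_sqrt_log_mul_rpow_neg {p : ℝ} (hp : 0 < p) :
    Tendsto (fun m : ℕ => √(Real.log m) * (m : ℝ) ^ (-p)) atTop (𝓝 0) := by
  have h1 : Tendsto (fun x : ℝ => Real.log x * x ^ (-p)) atTop (𝓝 0) := by
    refine ((isLittleO_log_rpow_atTop hp).tendsto_div_nhds_zero).congr' ?_
    filter_upwards [eventually_ge_atTop 0] with x hx
    rw [Real.rpow_neg hx, div_eq_mul_inv]
  refine squeeze_zero' (Eventually.of_forall fun m => by positivity) ?_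
    (h1.comp tendsto_natCast_atTop_atTop)
  filter_upwards [eventually_ge_atTop 3] with m hm
  have hL := one_lt_log_of_three_le hm
  refine mul_le_mul_of_nonneg_right ?_ (by positivity)
  exact Real.sqrt_le_iff.2 ⟨by linarith, by nlinarith⟩

theorem sqrt_rpow {x : ℝ} (hx : 0 ≤ x) (p : ℝ) : √(x ^ p) = x ^ (p / 2) := by
  rw [Real.sqrt_eq_rpow, ← Real.rpow_mul hx]
  congr 1
  ring

theorem exp_neg_mul_log {m : ℕ} (hm : 3 ≤ m) (r : ℝ) :
    Real.exp (-(r * Real.log m)) = (m : ℝ) ^ (-r) := by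
  rw [Real.rpow_def_of_pos (by positivity)]
  congr 1
  ring

theorem gaussTail_le_rpow {m : ℕ} (hm : 3 ≤ m) {r t : ℝ} (ht1 : 1 ≤ t)
    (ht : √(2 * r * Real.log m) ≤ t) : gaussTail t ≤ (m : ℝ) ^ (-r) := by
  have hL := one_lt_log_of_three_le hm
  have h1 : 2 * r * Real.log m ≤ t ^ 2 := (Real.sqrt_le_left (by linarith)).1 ht
  have h2 : Real.exp (-t ^ 2 / 2) ≤ (m : ℝ) ^ (-r) := by
    rw [← exp_neg_mul_log hm]
    exact Real.exp_le_exp.2 (by linarith)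
  have := Real.exp_nonneg (-t ^ 2 / 2)
  linarith [gaussTail_le_exp ht1]

theorem rpow_le_mul_gaussTail {m : ℕ} (hm : 3 ≤ m) {r t : ℝ} (ht1 : 1 ≤ t)
    (ht : t ≤ √(2 * r * Real.log m)) (ht5 : t ≤ √(5 * Real.log m)) :
    (m : ℝ) ^ (-r) ≤ 45 * (√(Real.log m) * gaussTail t) := by
  have hL := one_lt_log_of_three_le hm
  have h1 : t ^ 2 ≤ 2 * r * Real.log m := (Real.le_sqrt' (by linarith)).1 ht
  have h2 : (m : ℝ) ^ (-r) ≤ Real.exp (-t ^ 2 / 2) := by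
    rw [← exp_neg_mul_log hm]
    exact Real.exp_le_exp.2 (by linarith)
  have h5 : √5 ≤ 3 := by rw [Real.sqrt_le_left (by norm_num)]; norm_num
  have h3 : t ≤ 3 * √(Real.log m) := by
    rw [Real.sqrt_mul (by norm_num)] at ht5
    exact ht5.trans (mul_le_mul_of_nonneg_right h5 (Real.sqrt_nonneg _))
  have h4 := mul_le_mul_of_nonneg_right h3 (gaussTail_nonneg t)
  linarith [exp_le_mul_gaussTail ht1]

theorem sqrt_two_mul_mul_log (r : ℝ) (hr : 0 ≤ r) (m : ℕ) :
    √(2 * r * Real.log m) = √(2 * r) * √(Real.log m) :=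
  Real.sqrt_mul (by positivity) _

theorem tendsto_mul_sqrt_log_add {a b c : ℝ} (h : a < b) :
    Tendsto (fun m : ℕ => b * √(Real.log m) - a * √(Real.log m) + c) atTop atTop := by
  simp_rw [← sub_mul]
  exact tendsto_atTop_add_const_right _ _
    (tendsto_sqrt_log_natCast.const_mul_atTop (sub_pos.2 h))

theorem eventually_ceil_mem_grid {r : ℝ} (hr : 0 < r) (hr5 : r < 5 / 2) :
    ∀ᶠ m : ℕ in atTop, ⌈√(2 * r * Real.log m)⌉₊ ∈ grid m := by
  have h1 : ∀ᶠ m : ℕ in atTop, Real.log (Real.log m) ≤ 2 * r * Real.log m := by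
    have := (Real.isLittleO_log_id_atTop.comp_tendsto tendsto_log_natCast).bound
      (by positivity : 0 < 2 * r)
    filter_upwards [this, eventually_ge_atTop 3] with m hm hm3
    have hL := one_lt_log_of_three_le hm3
    simp only [Function.comp_apply, id, Real.norm_eq_abs] at hm
    rw [abs_of_pos (by linarith : 0 < Real.log m)] at hm
    exact (le_abs_self _).trans hm
  have h2 : √(2 * r) < √5 := Real.sqrt_lt_sqrt (by positivity) (by linarith)
  filter_upwards [h1, (tendsto_mul_sqrt_log_add (c := -1) h2).eventually_ge_atTop 0] with m hm1 hm2
  rw [mem_grid]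
  refine ⟨(Real.sqrt_le_sqrt hm1).trans (Nat.le_ceil _), ?_⟩
  have h3 := (Nat.ceil_lt_add_one (Real.sqrt_nonneg (2 * r * Real.log m))).le
  rw [Real.sqrt_mul (by norm_num : (0 : ℝ) ≤ 5)]
  have h4 := sqrt_two_mul_mul_log r hr.le m
  linarith

/-! ### The constants diverge -/

/-- Somewhere along the sequence a single exceedance of a high grid point makes both null
statistics larger than `M √(log m)`. -/
theorem exists_single_exceedance_large (M : ℝ) :
    ∃ m : ℕ, 3 ≤ m ∧ ∃ t ∈ grid m,
      M * √(Real.log m) * gaussTail t ^ (1 / 2 : ℝ) + gaussTail t < (m : ℝ)⁻¹ := by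
  have h1 := (tendsto_sqrt_log_mul_rpow_neg (p := 1 / 8) (by norm_num)).const_mul (|M| + 1)
  rw [mul_zero] at h1
  obtain ⟨m, hgrid, hm, hlt⟩ := ((eventually_ceil_mem_grid (r := 9 / 4) (by norm_num)
    (by norm_num)).and ((eventually_ge_atTop 3).and (h1.eventually_lt_const one_pos))).exists
  refine ⟨m, hm, _, hgrid, ?_⟩
  set t : ℕ := ⌈√(2 * (9 / 4) * Real.log m)⌉₊
  have ht1 := one_le_of_mem_grid hm hgrid
  have hm0 : (0 : ℝ) < m := by positivity
  have hT := gaussTail_le_rpow hm (r := 9 / 4) ht1 (Nat.le_ceil _)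
  have hT0 := gaussTail_nonneg (t : ℝ)
  have hhalf : gaussTail t ^ (1 / 2 : ℝ) ≤ (m : ℝ) ^ (-(1 / 8) : ℝ) * (m : ℝ)⁻¹ := by
    refine (Real.rpow_le_rpow hT0 hT (by norm_num)).trans_eq ?_
    rw [← Real.rpow_mul hm0.le, ← Real.rpow_neg_one, ← Real.rpow_add hm0]
    norm_num
  have hself : gaussTail t ≤ gaussTail t ^ (1 / 2 : ℝ) := by
    nth_rewrite 1 [← Real.rpow_one (gaussTail t)]
    exact Real.rpow_le_rpow_of_exponent_ge (gaussTail_pos _) (gaussTail_le_one _) (by norm_num)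
  have hL : 1 ≤ √(Real.log m) := Real.one_le_sqrt.2 (one_lt_log_of_three_le hm).le
  have hG : 0 ≤ gaussTail t ^ (1 / 2 : ℝ) := Real.rpow_nonneg hT0 _
  calc M * √(Real.log m) * gaussTail t ^ (1 / 2 : ℝ) + gaussTail t
      ≤ |M| * √(Real.log m) * gaussTail t ^ (1 / 2 : ℝ) +
        √(Real.log m) * gaussTail t ^ (1 / 2 : ℝ) := by
        refine add_le_add ?_ (hself.trans (le_mul_of_one_le_left hG hL))
        gcongr
        exact le_abs_self M
    _ = (|M| + 1) * √(Real.log m) * gaussTail t ^ (1 / 2 : ℝ) := by ring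
    _ ≤ (|M| + 1) * √(Real.log m) * ((m : ℝ) ^ (-(1 / 8) : ℝ) * (m : ℝ)⁻¹) := by gcongr
    _ = (|M| + 1) * (√(Real.log m) * (m : ℝ) ^ (-(1 / 8) : ℝ)) * (m : ℝ)⁻¹ := by ring
    _ < 1 * (m : ℝ)⁻¹ := mul_lt_mul_of_pos_right hlt (by positivity)
    _ = _ := one_mul _

theorem lt_nullStat_univ_of_exceed {m : ℕ} {θ b : ℝ} {t : ℕ} (ht : t ∈ grid m)
    {x : EuclideanSpace ℝ (Fin m)} {i : Fin m} (hi : t < x i)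
    (h : b * gaussTail t ^ θ + gaussTail t < (m : ℝ)⁻¹) : b < nullStat θ Finset.univ x := by
  refine (Finset.lt_sup'_iff _).2 ⟨t, ht, ?_⟩
  rw [lt_div_iff₀ (Real.rpow_pos_of_pos (gaussTail_pos _) _)]
  have h1 : (m : ℝ)⁻¹ ≤ exceedFrac Finset.univ x t := by
    rw [exceedFrac, Finset.card_univ, Fintype.card_fin]
    refine le_mul_of_one_le_right (by positivity) ?_
    have := Finset.single_le_sum (f := fun i => if (t : ℝ) < x i then (1 : ℝ) else 0)
      (fun i _ => by split_ifs <;> norm_num) (Finset.mem_univ i)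
    simpa [hi] using this
  exact lt_of_lt_of_le (by linarith) (le_abs_self _)

/-- Constants for which the null statistic stays below the bounding sequence with probability more
than `1 - a` for all `m` simultaneously must tend to infinity as `a → 0`, because no fixed
constant bounds the null statistic almost surely for all `m`. The bounding sequence `bnd` enters
only through the fact that it is monotone in the constant and at most `M √(log m)`. -/
theorem eventually_le_constant {θ : ℝ} (hθ : 1 / 2 ≤ θ) {S : (m : ℕ) → Matrix (Fin m) (Fin m) ℝ}
    (hS : ∀ m, 3 ≤ m → IsCorrelation (S m)) {bnd : ℝ → ℕ → ℝ}
    (hmono : ∀ m, Monotone fun C => bnd C m)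
    (hbnd : ∀ M m, 0 ≤ M → 3 ≤ m → bnd M m ≤ M * √(Real.log m)) {C : ℝ → ℝ}
    (hC : ∀ a : ℝ, 0 < a → a < 1 → ∀ m, 3 ≤ m →
      (multivariateGaussian 0 (S m)).real {x | bnd (C a) m < nullStat θ Finset.univ x} < a)
    {α : ℕ → ℝ} (hα : ∀ m, 0 < α m ∧ α m < 1) (hα0 : Tendsto α atTop (𝓝 0)) (M : ℝ)
    (hM : 0 ≤ M) : ∀ᶠ m in atTop, M ≤ C (α m) := by
  obtain ⟨k, hk, t, ht, h⟩ := exists_single_exceedance_large M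
  have hbk : bnd M k * gaussTail t ^ θ + gaussTail t < (k : ℝ)⁻¹ := by
    refine lt_of_le_of_lt (add_le_add_left ?_ _) h
    exact mul_le_mul (hbnd M k hM hk) (gaussTail_rpow_le_half hθ)
      (Real.rpow_nonneg (gaussTail_nonneg _) _) (by positivity)
  filter_upwards [hα0.eventually_lt_const (gaussTail_pos (t : ℝ))] with m hm
  by_contra hlt
  push Not at hlt
  let i : Fin k := ⟨0, by omega⟩
  have h1 : gaussTail t ≤
      (multivariateGaussian 0 (S k)).real {x | bnd (C (α m)) k < nullStat θ Finset.univ x} := by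
    have := measureReal_exceed (μ := 0) (hS k hk) t i
    rw [PiLp.zero_apply, sub_zero] at this
    rw [← this]
    exact measureReal_mono fun x hx =>
      (hmono k hlt.le).trans_lt (lt_nullStat_univ_of_exceed ht hx hbk)
  linarith [hC (α m) (hα m).1 (hα m).2 k hk]

theorem monotone_boundOne (m : ℕ) : Monotone fun C => boundOne C m := fun _ _ h =>
  mul_le_mul_of_nonneg_right h (Real.sqrt_nonneg _)

theorem monotone_boundHalf (η : ℝ) (m : ℕ) : Monotone fun C => boundHalf C η m := fun _ _ h =>
  mul_le_mul_of_nonneg_right h (Real.sqrt_nonneg _)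

theorem boundHalf_le {η : ℝ} (hη : 0 ≤ η) {M : ℝ} {m : ℕ} (hM : 0 ≤ M) (hm : 3 ≤ m) :
    boundHalf M η m ≤ M * √(Real.log m) := by
  have hm1 : (1 : ℝ) ≤ m := by exact_mod_cast (by omega : 1 ≤ m)
  have h : (m : ℝ) ^ (-η) ≤ 1 := Real.rpow_le_one_of_one_le_of_nonpos hm1 (by linarith)
  exact mul_le_mul_of_nonneg_left
    (Real.sqrt_le_sqrt (mul_le_of_le_one_left (Real.log_natCast_nonneg m) h)) hM

/-! ### The signals -/

section Signals

variable {m : ℕ} {μ : EuclideanSpace ℝ (Fin m)} {S : Matrix (Fin m) (Fin m) ℝ} {h : ℝ}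

theorem integrable_exceedFrac (I : Finset (Fin m)) (t : ℝ) :
    Integrable (fun x => exceedFrac I x t) (multivariateGaussian μ S) :=
  (integrable_finsetSum _ fun i _ => integrable_exceed t i).const_mul _

theorem integral_exceedFrac_signalSet (hS : IsCorrelation S) (hμ : MeanCalib μ h)
    (hπ : 0 < signalProp μ) (t : ℝ) :
    ∫ x, exceedFrac (signalSet μ) x t ∂multivariateGaussian μ S =
      gaussTail (t - √(2 * h * Real.log m)) := by
  have hcard : ((signalSet μ).card : ℝ) ≠ 0 := fun h0 => by
    rw [signalProp, h0, zero_div] at hπ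
    exact hπ.false
  simp_rw [exceedFrac]
  rw [integral_const_mul, integral_finsetSum _ fun i _ => integrable_exceed t i,
    Finset.sum_congr rfl fun i hi => by
      rw [integral_exceed hS, hμ i (Finset.mem_filter.1 hi).2],
    Finset.sum_const, nsmul_eq_mul, inv_mul_cancel_left₀ hcard]

theorem measureReal_le_exceedFrac_signalSet (hS : IsCorrelation S) (hμ : MeanCalib μ h)
    (hπ : 0 < signalProp μ) (t : ℝ) {ε : ℝ} (hε : 0 < ε) :
    (multivariateGaussian μ S).real {x | ε ≤ exceedFrac (signalSet μ) x t} ≤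
      gaussTail (t - √(2 * h * Real.log m)) / ε := by
  rw [le_div_iff₀ hε, mul_comm, ← integral_exceedFrac_signalSet hS hμ hπ]
  exact mul_meas_ge_le_integral_of_nonneg
    (Eventually.of_forall fun x => exceedFrac_nonneg _ x t) (integrable_exceedFrac _ t) ε

theorem measureReal_exceedFrac_signalSet_le (hS : IsCorrelation S) (hμ : MeanCalib μ h)
    (hπ : 0 < signalProp μ) (t : ℝ) {ε : ℝ} (hε : 0 < ε) :
    (multivariateGaussian μ S).real {x | exceedFrac (signalSet μ) x t ≤ 1 - ε} ≤
      (1 - gaussTail (t - √(2 * h * Real.log m))) / ε := by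
  have hint := integrable_exceedFrac (μ := μ) (S := S) (signalSet μ) t
  have h1 := mul_meas_ge_le_integral_of_nonneg
    (Eventually.of_forall fun x => sub_nonneg.2 (exceedFrac_le_one (signalSet μ) x t))
    ((integrable_const (1 : ℝ)).sub hint) ε
  rw [integral_sub (integrable_const _) hint, integral_exceedFrac_signalSet hS hμ hπ,
    integral_const, probReal_univ, one_smul] at h1
  rw [le_div_iff₀ hε, mul_comm]
  refine le_trans (mul_le_mul_of_nonneg_left (measureReal_mono fun x hx => ?_) hε.le) h1
  rw [Set.mem_ofPred_eq] at hx ⊢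
  linarith

theorem lt_piHatTheta (hm : 3 ≤ m) {θ c ε : ℝ} (hε1 : ε ≤ 1)
    {t : ℕ} (ht : t ∈ grid m) {x : EuclideanSpace ℝ (Fin m)}
    (hnoise : |centredAvg (noiseSet μ) t x| < c * gaussTail t ^ θ)
    (hsignal : 1 - ε / 4 < exceedFrac (signalSet μ) x t) (htail : gaussTail t ≤ ε / 4)
    (hc : c * gaussTail t ^ θ ≤ ε / 4 * signalProp μ) :
    (1 - ε) * signalProp μ < piHatTheta θ c x := by
  refine (Finset.lt_sup'_iff _).2 ⟨t, ht, ?_⟩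
  have hT := gaussTail_le_half (one_le_of_mem_grid hm ht)
  have hT0 := gaussTail_nonneg (t : ℝ)
  have hπ := signalProp_nonneg (μ := μ)
  rw [lt_div_iff₀ (by linarith), exceedFrac_univ_sub (μ := μ) hm]
  have h1 := (abs_lt.1 hnoise).1
  have h2 : (1 - ε) * signalProp μ * (1 - gaussTail t) ≤ (1 - ε) * signalProp μ :=
    mul_le_of_le_one_right (mul_nonneg (by linarith) hπ) (by linarith)
  have h3 : signalProp μ * (1 - ε / 4 - ε / 4) ≤
      signalProp μ * (exceedFrac (signalSet μ) x t - gaussTail t) :=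
    mul_le_mul_of_nonneg_left (by linarith) hπ
  linarith

/-- Below the boundary, each grid point is either so low that the bounding sequence exceeds the
signal proportion, or so high that hardly any signal exceeds it. -/
theorem piHatTheta_lt_mul (hm : 3 ≤ m) {θ c ε : ℝ} (hε : 0 < ε) (hπ : 0 < signalProp μ)
    {x : EuclideanSpace ℝ (Fin m)}
    (hnoise : ∀ t ∈ grid m, |centredAvg (noiseSet μ) t x| < c * gaussTail t ^ θ)
    (hsignal : ∀ t ∈ grid m, signalProp μ ≤ c * gaussTail t ^ θ ∨
      exceedFrac (signalSet μ) x t < ε / 2) :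
    piHatTheta θ (2 * c) x < ε * signalProp μ := by
  rw [piHatTheta, Finset.sup'_lt_iff]
  intro t ht
  have hT := gaussTail_le_half (one_le_of_mem_grid hm ht)
  have hT0 := gaussTail_nonneg (t : ℝ)
  rw [div_lt_iff₀ (by linarith), exceedFrac_univ_sub (μ := μ) hm]
  have h1 := (abs_lt.1 (hnoise t ht)).2
  have h2 := (abs_nonneg _).trans_lt (hnoise t ht)
  have h3 : ε / 2 * signalProp μ ≤ ε * signalProp μ * (1 - gaussTail t) := by
    have : 0 < ε * signalProp μ := by positivity
    nlinarith
  have h0 := mul_nonneg hπ.le hT0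
  rcases hsignal t ht with h4 | h4
  · have h5 := mul_le_mul_of_nonneg_left (exceedFrac_le_one (signalSet μ) x t) hπ.le
    have : 0 < ε / 2 * signalProp μ := by positivity
    linarith
  · have h5 := mul_lt_mul_of_pos_left h4 hπ
    linarith

theorem neg_lt_piHatTheta_one (hm : 3 ≤ m) {c ε : ℝ} {t : ℕ} (ht : t ∈ grid m)
    (hc1 : 1 ≤ c) (hc : c * gaussTail t ^ (1 : ℝ) < ε / 4 * signalProp μ)
    (x : EuclideanSpace ℝ (Fin m)) : -(ε * signalProp μ) < piHatTheta 1 c x := by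
  refine (Finset.lt_sup'_iff _).2 ⟨t, ht, ?_⟩
  have hT := gaussTail_le_half (one_le_of_mem_grid hm ht)
  have hT0 := gaussTail_nonneg (t : ℝ)
  rw [lt_div_iff₀ (by linarith)]
  rw [Real.rpow_one] at hc ⊢
  have h1 := exceedFrac_nonneg Finset.univ x t
  have h2 : gaussTail t ≤ c * gaussTail t := le_mul_of_one_le_left hT0 hc1
  have h3 : 0 < ε * signalProp μ := by linarith
  nlinarith

end Signals

/-! ### Consistency above the boundary -/

section Asymptotics

variable {γ η h : ℝ} {S : (m : ℕ) → Matrix (Fin m) (Fin m) ℝ}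
  {μ : (m : ℕ) → EuclideanSpace ℝ (Fin m)}

theorem eventually_signalProp
    (hπ : Tendsto (fun m : ℕ => signalProp (μ m) * (m : ℝ) ^ γ) atTop (𝓝 1)) :
    ∀ᶠ m : ℕ in atTop, 1 / 2 * (m : ℝ) ^ (-γ) ≤ signalProp (μ m) ∧
      signalProp (μ m) ≤ 2 * (m : ℝ) ^ (-γ) ∧ 0 < signalProp (μ m) := by
  filter_upwards [hπ.eventually_const_le (by norm_num : (1 / 2 : ℝ) < 1),
    hπ.eventually_le_const (by norm_num : (1 : ℝ) < 2), eventually_ge_atTop 1] with m h1 h2 hm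
  have hm0 : (0 : ℝ) < m := by exact_mod_cast hm
  have hp : 0 < (m : ℝ) ^ γ := Real.rpow_pos_of_pos hm0 _
  rw [Real.rpow_neg hm0.le, ← div_eq_mul_inv, ← div_eq_mul_inv, div_le_iff₀ hp, le_div_iff₀ hp]
  exact ⟨h1, h2, pos_of_mul_pos_left (by linarith : 0 < signalProp (μ m) * (m : ℝ) ^ γ) hp.le⟩

/-- Above `√(2 r log m)` with `r > γ`, the bounding sequence for `θ = 1` is negligible relative to
the signal proportion. -/
theorem eventually_boundOne_le {r : ℝ} (hr : γ < r) {C : ℕ → ℝ} (hC0 : ∀ᶠ m in atTop, 0 ≤ C m)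
    (hC : ∀ δ : ℝ, 0 < δ → ∀ᶠ m : ℕ in atTop, C m ≤ (m : ℝ) ^ δ) {κ : ℝ} (hκ : 0 < κ) :
    ∀ᶠ m : ℕ in atTop, ∀ t : ℝ, 1 ≤ t → √(2 * r * Real.log m) ≤ t →
      boundOne (C m) m * gaussTail t ^ (1 : ℝ) ≤ κ * (m : ℝ) ^ (-γ) := by
  set δ := (r - γ) / 2 with hδ
  have hδ0 : 0 < δ := by rw [hδ]; linarith
  filter_upwards [hC0, hC δ hδ0, eventually_ge_atTop 3,
    (tendsto_sqrt_log_mul_rpow_neg hδ0).eventually_le_const hκ] with m h0 h1 hm h2 t ht1 ht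
  have hm0 : (0 : ℝ) < m := by positivity
  have hT := gaussTail_le_rpow hm ht1 ht
  have hT0 := gaussTail_nonneg t
  rw [Real.rpow_one, boundOne]
  calc C m * √(Real.log m) * gaussTail t
      ≤ (m : ℝ) ^ δ * √(Real.log m) * (m : ℝ) ^ (-r) := by gcongr
    _ = √(Real.log m) * ((m : ℝ) ^ δ * (m : ℝ) ^ (-r)) := by ring
    _ = √(Real.log m) * ((m : ℝ) ^ (-δ) * (m : ℝ) ^ (-γ)) := by
        rw [← Real.rpow_add hm0, ← Real.rpow_add hm0]
        congr 2
        rw [hδ]; ring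
    _ = √(Real.log m) * (m : ℝ) ^ (-δ) * (m : ℝ) ^ (-γ) := by ring
    _ ≤ κ * (m : ℝ) ^ (-γ) := by gcongr

/-- Above `√(2 r log m)` with `r > 2 γ - η`, the bounding sequence for `θ = 1 / 2` is negligible
relative to the signal proportion. -/
theorem eventually_boundHalf_le {r : ℝ} (hr : 2 * γ - η < r) {C : ℕ → ℝ}
    (hC0 : ∀ᶠ m in atTop, 0 ≤ C m)
    (hC : ∀ δ : ℝ, 0 < δ → ∀ᶠ m : ℕ in atTop, C m ≤ (m : ℝ) ^ δ) {κ : ℝ} (hκ : 0 < κ) :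
    ∀ᶠ m : ℕ in atTop, ∀ t : ℝ, 1 ≤ t → √(2 * r * Real.log m) ≤ t →
      boundHalf (C m) η m * gaussTail t ^ (1 / 2 : ℝ) ≤ κ * (m : ℝ) ^ (-γ) := by
  set δ := (r + η - 2 * γ) / 4 with hδ
  have hδ0 : 0 < δ := by rw [hδ]; linarith
  filter_upwards [hC0, hC δ hδ0, eventually_ge_atTop 3,
    (tendsto_sqrt_log_mul_rpow_neg hδ0).eventually_le_const hκ] with m h0 h1 hm h2 t ht1 ht
  have hm0 : (0 : ℝ) < m := by positivity
  have hT := Real.sqrt_le_sqrt (gaussTail_le_rpow hm ht1 ht)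
  rw [← Real.sqrt_eq_rpow, boundHalf, Real.sqrt_mul (by positivity), sqrt_rpow hm0.le]
  rw [sqrt_rpow hm0.le] at hT
  calc C m * ((m : ℝ) ^ (-η / 2) * √(Real.log m)) * √(gaussTail t)
      ≤ (m : ℝ) ^ δ * ((m : ℝ) ^ (-η / 2) * √(Real.log m)) * (m : ℝ) ^ (-r / 2) := by gcongr
    _ = √(Real.log m) * ((m : ℝ) ^ δ * (m : ℝ) ^ (-η / 2) * (m : ℝ) ^ (-r / 2)) := by ring
    _ = √(Real.log m) * ((m : ℝ) ^ (-δ) * (m : ℝ) ^ (-γ)) := by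
        rw [← Real.rpow_add hm0, ← Real.rpow_add hm0, ← Real.rpow_add hm0]
        congr 2
        rw [hδ]; ring
    _ = √(Real.log m) * (m : ℝ) ^ (-δ) * (m : ℝ) ^ (-γ) := by ring
    _ ≤ κ * (m : ℝ) ^ (-γ) := by gcongr

theorem tendsto_noise_error {CHalf COne : ℕ → ℝ} (hHalf : Tendsto CHalf atTop atTop)
    (hOne : Tendsto COne atTop atTop) :
    Tendsto (fun m => 75 / CHalf m ^ 2 + 6 / COne m) atTop (𝓝 0) := by
  have h1 := ((tendsto_pow_atTop two_ne_zero).comp hHalf).const_div_atTop 75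
  simpa using h1.add (hOne.const_div_atTop 6)

/-- Outside an event of vanishing probability, the noise stays below both bounding sequences. -/
theorem eventually_measureReal_noise_le
    (hS : ∀ m, 3 ≤ m → IsCorrelation (S m) ∧ DependenceCalib (S m) η)
    {CHalf COne : ℕ → ℝ} (hHalf : Tendsto CHalf atTop atTop) (hOne : Tendsto COne atTop atTop) :
    ∀ᶠ m in atTop, (multivariateGaussian (μ m) (S m)).real
      ({x | ∃ t ∈ grid m, boundHalf (CHalf m) η m * gaussTail t ^ (1 / 2 : ℝ) ≤
          |centredAvg (noiseSet (μ m)) t x|} ∪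
        {x | ∃ t ∈ grid m, boundOne (COne m) m * gaussTail t ^ (1 : ℝ) ≤
          |centredAvg (noiseSet (μ m)) t x|}) ≤ 75 / CHalf m ^ 2 + 6 / COne m := by
  filter_upwards [hHalf.eventually_gt_atTop 0, hOne.eventually_gt_atTop 0, eventually_ge_atTop 3]
    with m h1 h2 hm
  exact (measureReal_union_le _ _).trans (add_le_add
    (measureReal_boundHalf_le hm (hS m hm).1 (hS m hm).2
      (fun i => eq_zero_of_mem_noiseSet) h1)
    (measureReal_boundOne_le hm (hS m hm).1 (fun i => eq_zero_of_mem_noiseSet) h2))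

theorem tendsto_measureReal_piHat_consistent (hh : 0 < h)
    (hS : ∀ m, 3 ≤ m → IsCorrelation (S m) ∧ DependenceCalib (S m) η ∧ MeanCalib (μ m) h)
    (hπ : Tendsto (fun m : ℕ => signalProp (μ m) * (m : ℝ) ^ γ) atTop (𝓝 1)) (hγ1 : γ < 1)
    (hη0 : 0 ≤ η)
    {CHalf COne : ℕ → ℝ} (hHalf : Tendsto CHalf atTop atTop) (hOne : Tendsto COne atTop atTop)
    (hHalfG : ∀ δ : ℝ, 0 < δ → ∀ᶠ m : ℕ in atTop, CHalf m ≤ (m : ℝ) ^ δ)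
    (hOneG : ∀ δ : ℝ, 0 < δ → ∀ᶠ m : ℕ in atTop, COne m ≤ (m : ℝ) ^ δ)
    (hth : γ < h ∨ 2 * γ - η < h) {ε : ℝ} (hε : 0 < ε) (hε1 : ε ≤ 1) :
    Tendsto (fun m : ℕ => (multivariateGaussian (μ m) (S m)).real
      {x | (1 - ε) * signalProp (μ m) < piHat (boundHalf (CHalf m) η m) (boundOne (COne m) m) x ∧
        piHat (boundHalf (CHalf m) η m) (boundOne (COne m) m) x < signalProp (μ m)})
      atTop (𝓝 1) := by
  -- the detection level `√(2 r log m)`: below the signal strength, inside the grid, and high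
  -- enough for one of the two bounding sequences to be negligible
  obtain ⟨r, hr0, hrh, hr5, hr⟩ :
      ∃ r, 0 < r ∧ r < h ∧ r < 5 / 2 ∧ (γ < r ∨ 2 * γ - η < r) := by
    rcases hth with h1 | h1
    · obtain ⟨r, h2, h3⟩ := exists_between (a₁ := max γ 0) (a₂ := min h (5 / 2))
        (lt_min (max_lt h1 hh) (max_lt (by linarith) (by norm_num)))
      rw [max_lt_iff] at h2
      rw [lt_min_iff] at h3
      exact ⟨r, h2.2, h3.1, h3.2, Or.inl h2.1⟩
    · obtain ⟨r, h2, h3⟩ := exists_between (a₁ := max (2 * γ - η) 0) (a₂ := min h (5 / 2))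
        (lt_min (max_lt h1 hh) (max_lt (by linarith) (by norm_num)))
      rw [max_lt_iff] at h2
      rw [lt_min_iff] at h3
      exact ⟨r, h2.2, h3.1, h3.2, Or.inr h2.1⟩
  set t : ℕ → ℕ := fun m => ⌈√(2 * r * Real.log m)⌉₊ with ht
  have htlarge : Tendsto (fun m => (t m : ℝ)) atTop atTop := by
    refine tendsto_atTop_mono (fun m => Nat.le_ceil _) ?_
    simp_rw [sqrt_two_mul_mul_log r hr0.le]
    exact tendsto_sqrt_log_natCast.const_mul_atTop (by positivity)
  have htb : Tendsto (fun m => (t m : ℝ) - √(2 * h * Real.log m)) atTop atBot := by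
    have h1 := tendsto_mul_sqrt_log_add (c := -1)
      (Real.sqrt_lt_sqrt (by positivity : 0 ≤ 2 * r) (by linarith : 2 * r < 2 * h))
    refine tendsto_atBot_mono (fun m => ?_) (tendsto_neg_atTop_atBot.comp h1)
    have h3 := (Nat.ceil_lt_add_one (Real.sqrt_nonneg (2 * r * Real.log m))).le
    have h4 := sqrt_two_mul_mul_log r hr0.le m
    rw [sqrt_two_mul_mul_log h hh.le, Function.comp_apply]
    simp only [ht]
    linarith
  have hHalf0 : ∀ᶠ m in atTop, 0 ≤ CHalf m := hHalf.eventually_ge_atTop 0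
  have hOne0 : ∀ᶠ m in atTop, 0 ≤ COne m := hOne.eventually_ge_atTop 0
  have hπev := eventually_signalProp hπ
  have hneg : ∀ᶠ m in atTop,
      boundOne (COne m) m * gaussTail (t m) ^ (1 : ℝ) ≤ ε / 4 * signalProp (μ m) ∨
      boundHalf (CHalf m) η m * gaussTail (t m) ^ (1 / 2 : ℝ) ≤ ε / 4 * signalProp (μ m) := by
    rcases hr with h1 | h1
    · filter_upwards [eventually_boundOne_le h1 hOne0 hOneG (by positivity : 0 < ε / 8), hπev,
        htlarge.eventually_ge_atTop 1] with m h2 h3 h4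
      have := h2 (t m) h4 (Nat.le_ceil _)
      exact Or.inl (by nlinarith [h3.1])
    · filter_upwards [eventually_boundHalf_le h1 hHalf0 hHalfG (by positivity : 0 < ε / 8), hπev,
        htlarge.eventually_ge_atTop 1] with m h2 h3 h4
      have := h2 (t m) h4 (Nat.le_ceil _)
      exact Or.inr (by nlinarith [h3.1])
  have herr : Tendsto (fun m => 1 - (75 / CHalf m ^ 2 + 6 / COne m +
      (1 - gaussTail (t m - √(2 * h * Real.log m))) / (ε / 4))) atTop (𝓝 1) := by
    have h1 := ((tendsto_gaussTail_atBot.comp htb).const_sub 1).div_const (ε / 4)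
    simpa using ((tendsto_noise_error hHalf hOne).add h1).const_sub 1
  refine tendsto_of_tendsto_of_tendsto_of_le_of_le' herr tendsto_const_nhds ?_
    (Eventually.of_forall fun m => measureReal_le_one)
  filter_upwards [hneg, hπev, eventually_ceil_mem_grid hr0 hr5, eventually_ge_atTop 3,
    (tendsto_gaussTail_atTop.comp htlarge).eventually_le_const (by positivity : 0 < ε / 4),
    eventually_measureReal_noise_le (μ := μ) (fun m hm => ⟨(hS m hm).1, (hS m hm).2.1⟩) hHalf hOne]
    with m h1 h2 h3 hm h4 h5
  have h6 := measureReal_exceedFrac_signalSet_le (hS m hm).1 (hS m hm).2.2 h2.2.2 (t m)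
    (by positivity : 0 < ε / 4)
  refine (sub_le_sub_left (add_le_add h5 h6) 1).trans
    (one_sub_le_measureReal _ fun x hx1 hx2 => ?_)
  simp only [Set.mem_union, Set.mem_ofPred_eq, not_or] at hx1 hx2
  refine ⟨?_, piHat_lt_signalProp hm hx1.1 hx1.2⟩
  push Not at hx1 hx2
  rcases h1 with h1 | h1
  · exact lt_max_of_lt_right (lt_piHatTheta hm hε1 h3 (hx1.2 _ h3) hx2 h4 h1)
  · exact lt_max_of_lt_left (lt_piHatTheta hm hε1 h3 (hx1.1 _ h3) hx2 h4 h1)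

/-! ### Inconsistency below the boundary -/

/-- Up to `√(2 r log m)` with `r < γ`, the bounding sequence for `θ = 1` exceeds the signal
proportion. -/
theorem eventually_signalProp_le_boundOne {r : ℝ} (hr : r < γ)
    (hπ : Tendsto (fun m : ℕ => signalProp (μ m) * (m : ℝ) ^ γ) atTop (𝓝 1))
    {C : ℕ → ℝ} (hC : ∀ᶠ m in atTop, 1 ≤ C m) :
    ∀ᶠ m : ℕ in atTop, ∀ t ∈ grid m, (t : ℝ) ≤ √(2 * r * Real.log m) →
      signalProp (μ m) ≤ boundOne (C m) m * gaussTail t ^ (1 : ℝ) := by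
  filter_upwards [hC, eventually_signalProp hπ, eventually_ge_atTop 3,
    ((tendsto_natCast_rpow_neg (sub_pos.2 hr)).const_mul 90).eventually_le_const
      (by norm_num : (90 : ℝ) * 0 < 1)] with m h1 h2 hm h3 t ht htr
  have hm0 : (0 : ℝ) < m := by positivity
  have hT0 := gaussTail_nonneg (t : ℝ)
  have hT := rpow_le_mul_gaussTail hm (one_le_of_mem_grid hm ht) htr (mem_grid.1 ht).2
  have h4 : (m : ℝ) ^ (-γ) = (m : ℝ) ^ (-(γ - r)) * (m : ℝ) ^ (-r) := by
    rw [← Real.rpow_add hm0]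
    congr 1
    ring
  have h5 : 90 * (m : ℝ) ^ (-γ) ≤ (m : ℝ) ^ (-r) := by
    rw [h4, ← mul_assoc]
    exact mul_le_of_le_one_left (by positivity) h3
  have h6 : √(Real.log m) * gaussTail t ≤ C m * (√(Real.log m) * gaussTail t) :=
    le_mul_of_one_le_left (by positivity) h1
  rw [Real.rpow_one, boundOne, mul_assoc]
  linarith [h2.2.1]

/-- Up to `√(2 r log m)` with `r < 2 γ - η`, the bounding sequence for `θ = 1 / 2` exceeds the
signal proportion. -/
theorem eventually_signalProp_le_boundHalf {r : ℝ} (hr : r < 2 * γ - η)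
    (hπ : Tendsto (fun m : ℕ => signalProp (μ m) * (m : ℝ) ^ γ) atTop (𝓝 1))
    {C : ℕ → ℝ} (hC : ∀ᶠ m in atTop, 1 ≤ C m) :
    ∀ᶠ m : ℕ in atTop, ∀ t ∈ grid m, (t : ℝ) ≤ √(2 * r * Real.log m) →
      signalProp (μ m) ≤ boundHalf (C m) η m * gaussTail t ^ (1 / 2 : ℝ) := by
  filter_upwards [hC, eventually_signalProp hπ, eventually_ge_atTop 3,
    ((tendsto_natCast_rpow_neg (sub_pos.2 hr)).const_mul 180).eventually_le_const
      (by norm_num : (180 : ℝ) * 0 < 1)] with m h1 h2 hm h3 t ht htr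
  have hm0 : (0 : ℝ) < m := by positivity
  have hL := one_lt_log_of_three_le hm
  have hT0 := gaussTail_nonneg (t : ℝ)
  have hT := rpow_le_mul_gaussTail hm (one_le_of_mem_grid hm ht) htr (mem_grid.1 ht).2
  have h4 : ((m : ℝ) ^ (-γ)) ^ 2 = (m : ℝ) ^ (-(2 * γ - η - r)) * (m : ℝ) ^ (-r) *
      (m : ℝ) ^ (-η) := by
    rw [← Real.rpow_natCast, ← Real.rpow_mul hm0.le, ← Real.rpow_add hm0, ← Real.rpow_add hm0]
    congr 1
    push_cast
    ring
  have h5 : √(Real.log m) ≤ Real.log m := Real.sqrt_le_iff.2 ⟨by linarith, by nlinarith⟩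
  have h6 : (m : ℝ) ^ (-r) ≤ 45 * (Real.log m * gaussTail t) :=
    hT.trans (by gcongr)
  have h7 : (2 * (m : ℝ) ^ (-γ)) ^ 2 ≤ (m : ℝ) ^ (-η) * Real.log m * gaussTail t := by
    have h8 : 180 * (m : ℝ) ^ (-(2 * γ - η - r)) * ((m : ℝ) ^ (-r) * (m : ℝ) ^ (-η)) ≤
        (m : ℝ) ^ (-r) * (m : ℝ) ^ (-η) := mul_le_of_le_one_left (by positivity) h3
    have h9 : (m : ℝ) ^ (-r) * (m : ℝ) ^ (-η) ≤
        45 * (Real.log m * gaussTail t) * (m : ℝ) ^ (-η) := by gcongr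
    rw [mul_pow, h4]
    linarith
  have h10 := Real.le_sqrt_of_sq_le h7
  rw [Real.sqrt_mul (by positivity)] at h10
  rw [boundHalf, mul_assoc, ← Real.sqrt_eq_rpow]
  exact h2.2.1.trans (h10.trans (le_mul_of_one_le_left (by positivity) h1))

theorem boundOne_eq_two_mul_half (C : ℝ) (m : ℕ) : boundOne C m = 2 * boundOne (C / 2) m := by
  rw [boundOne, boundOne]; ring

theorem boundHalf_eq_two_mul_half (C η : ℝ) (m : ℕ) :
    boundHalf C η m = 2 * boundHalf (C / 2) η m := by
  rw [boundHalf, boundHalf]; ring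

theorem tendsto_measureReal_piHat_div_large (hh : 0 < h)
    (hS : ∀ m, 3 ≤ m → IsCorrelation (S m) ∧ DependenceCalib (S m) η ∧ MeanCalib (μ m) h)
    (hπ : Tendsto (fun m : ℕ => signalProp (μ m) * (m : ℝ) ^ γ) atTop (𝓝 1)) (hγ1 : γ < 1)
    {CHalf COne : ℕ → ℝ} (hHalf : Tendsto CHalf atTop atTop) (hOne : Tendsto COne atTop atTop)
    (hOneG : ∀ δ : ℝ, 0 < δ → ∀ᶠ m : ℕ in atTop, COne m ≤ (m : ℝ) ^ δ)
    (hth1 : h < γ) (hth2 : h < 2 * γ - η) {ε : ℝ} (hε : 0 < ε) :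
    Tendsto (fun m : ℕ => (multivariateGaussian (μ m) (S m)).real
      {x | ε < |piHat (boundHalf (CHalf m) η m) (boundOne (COne m) m) x / signalProp (μ m)|})
      atTop (𝓝 0) := by
  obtain ⟨r, hrh, hr⟩ := exists_between (lt_min hth1 hth2)
  obtain ⟨hr1, hr2⟩ := lt_min_iff.1 hr
  have hr0 : 0 < r := hh.trans hrh
  -- half of each bounding sequence absorbs the noise, the other half the signals
  have hHalf' : Tendsto (fun m => CHalf m / 2) atTop atTop := hHalf.atTop_div_const two_pos
  have hOne' : Tendsto (fun m => COne m / 2) atTop atTop := hOne.atTop_div_const two_pos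
  have hsb : Tendsto (fun m : ℕ => √(2 * r * Real.log m) - √(2 * h * Real.log m))
      atTop atTop := by
    have h1 := tendsto_mul_sqrt_log_add (c := 0)
      (Real.sqrt_lt_sqrt (by positivity : 0 ≤ 2 * h) (by linarith : 2 * h < 2 * r))
    simpa only [← sqrt_two_mul_mul_log _ hr0.le, ← sqrt_two_mul_mul_log _ hh.le, add_zero] using h1
  have herr : Tendsto (fun m : ℕ => 75 / (CHalf m / 2) ^ 2 + 6 / (COne m / 2) +
      gaussTail (√(2 * r * Real.log m) - √(2 * h * Real.log m)) / (ε / 2)) atTop (𝓝 0) := by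
    have h1 := (tendsto_gaussTail_atTop.comp hsb).div_const (ε / 2)
    simpa using (tendsto_noise_error hHalf' hOne').add h1
  refine squeeze_zero' (Eventually.of_forall fun m => measureReal_nonneg) ?_ herr
  -- a grid point at which the estimator is bounded below for trivial reasons
  have hlow := eventually_boundOne_le (γ := γ) (r := 2) (by linarith)
    (hOne.eventually_ge_atTop 0) hOneG (by positivity : 0 < ε / 16)
  filter_upwards [eventually_signalProp_le_boundOne hr1 hπ (hOne'.eventually_ge_atTop 1),
    eventually_signalProp_le_boundHalf hr2 hπ (hHalf'.eventually_ge_atTop 1),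
    eventually_signalProp hπ, eventually_ceil_mem_grid (r := 2) (by norm_num) (by norm_num),
    eventually_ge_atTop 3, hlow, hOne.eventually_ge_atTop 1,
    eventually_measureReal_noise_le (μ := μ) (fun m hm => ⟨(hS m hm).1, (hS m hm).2.1⟩) hHalf'
      hOne'] with m h1 h2 h3 hgrid hm h4 h5 h6
  have hπ0 := h3.2.2
  have h7 := measureReal_le_exceedFrac_signalSet (hS m hm).1 (hS m hm).2.2 hπ0
    √(2 * r * Real.log m) (by positivity : 0 < ε / 2)
  refine le_trans (measureReal_mono fun x hx => ?_)
    ((measureReal_union_le _ _).trans (add_le_add h6 h7))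
  by_contra hbad
  simp only [Set.mem_union, Set.mem_ofPred_eq, not_or] at hbad hx
  push Not at hbad
  obtain ⟨⟨hnHalf, hnOne⟩, hsig⟩ := hbad
  have hsig' : ∀ t ∈ grid m, ¬ (t : ℝ) ≤ √(2 * r * Real.log m) →
      exceedFrac (signalSet (μ m)) x t < ε / 2 := fun t _ ht' =>
    (exceedFrac_antitone _ x (not_le.1 ht').le).trans_lt hsig
  have hup : piHat (boundHalf (CHalf m) η m) (boundOne (COne m) m) x < ε * signalProp (μ m) := by
    rw [piHat, boundOne_eq_two_mul_half, boundHalf_eq_two_mul_half]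
    refine max_lt (piHatTheta_lt_mul hm hε hπ0 hnHalf fun t ht => ?_)
      (piHatTheta_lt_mul hm hε hπ0 hnOne fun t ht => ?_)
    · by_cases htr : (t : ℝ) ≤ √(2 * r * Real.log m)
      · exact Or.inl (h2 t ht htr)
      · exact Or.inr (hsig' t ht htr)
    · by_cases htr : (t : ℝ) ≤ √(2 * r * Real.log m)
      · exact Or.inl (h1 t ht htr)
      · exact Or.inr (hsig' t ht htr)
  have hdown : -(ε * signalProp (μ m)) <
      piHat (boundHalf (CHalf m) η m) (boundOne (COne m) m) x := by
    refine lt_max_of_lt_right (neg_lt_piHatTheta_one hm hgrid ?_ ?_ x)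
    · exact one_le_mul_of_one_le_of_one_le h5
        (Real.one_le_sqrt.2 (one_lt_log_of_three_le hm).le)
    · have := h4 _ (one_le_of_mem_grid hm hgrid) (Nat.le_ceil _)
      nlinarith [h3.1, mul_pos hε hπ0]
  rw [abs_div, abs_of_pos hπ0, lt_div_iff₀ hπ0] at hx
  exact absurd (abs_lt.2 ⟨hdown, hup⟩) hx.le.not_gt

end Asymptotics

end SignalProportion

open SignalProportion in
theorem proposition3p1 :
    -- lower bound property, explicit bounding sequences with large enough constants
    (∀ a : ℝ, 0 < a → a < 1 →
      ∃ K₁ KHalf : ℝ, 0 < K₁ ∧ 0 < KHalf ∧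
        ∀ C₁ CHalf : ℝ, K₁ ≤ C₁ → KHalf ≤ CHalf →
        ∀ η : ℝ, 0 ≤ η → η ≤ 1 →
          Monotone (fun k : ℕ => (k : ℝ) * boundOne C₁ k) ∧
          Monotone (fun k : ℕ => (k : ℝ) * boundHalf CHalf η k) ∧
          ∀ (m : ℕ), 3 ≤ m → ∀ S : Matrix (Fin m) (Fin m) ℝ,
            IsCorrelation S → DependenceCalib S η →
            (multivariateGaussian 0 S).real
              {x | boundOne C₁ m < nullStat 1 Finset.univ x} < a ∧
            (multivariateGaussian 0 S).real
              {x | boundHalf CHalf η m < nullStat (1 / 2) Finset.univ x} < a ∧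
            ∀ (γ h : ℝ) (μ : EuclideanSpace ℝ (Fin m)), 0 < γ → γ < 1 → 0 < h →
              MeanCalib μ h → signalProp μ = (m : ℝ) ^ (-γ) →
              1 - a ≤ (multivariateGaussian μ S).real
                {x | piHat (boundHalf CHalf η m) (boundOne C₁ m) x < signalProp μ}) ∧
    -- lower bound property, arbitrary bounding sequences, each of level `a / 2`
    (∀ a : ℝ, 0 < a → a < 1 → ∀ (m : ℕ), 3 ≤ m →
      ∀ S : Matrix (Fin m) (Fin m) ℝ, IsCorrelation S →
      ∀ (γ h : ℝ) (μ : EuclideanSpace ℝ (Fin m)), 0 < γ → γ < 1 → 0 < h →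
        MeanCalib μ h → signalProp μ = (m : ℝ) ^ (-γ) →
      ∀ cHalf cOne : ℕ → ℝ,
        ((noiseSet μ).card : ℝ) * cHalf (noiseSet μ).card < m * cHalf m →
        ((noiseSet μ).card : ℝ) * cOne (noiseSet μ).card < m * cOne m →
        (multivariateGaussian 0 S).real
          {x | cHalf (noiseSet μ).card < nullStat (1 / 2) (noiseSet μ) x} < a / 2 →
        (multivariateGaussian 0 S).real
          {x | cOne (noiseSet μ).card < nullStat 1 (noiseSet μ) x} < a / 2 →
        1 - a ≤ (multivariateGaussian μ S).real
          {x | piHat (cHalf m) (cOne m) x < signalProp μ}) ∧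
    -- consistency if, and almost only if, `h` exceeds the threshold
    (∀ (γ η h : ℝ), 0 < γ → γ < 1 → 0 ≤ η → η ≤ 1 → 0 < h →
      ∀ (S : (m : ℕ) → Matrix (Fin m) (Fin m) ℝ) (μ : (m : ℕ) → EuclideanSpace ℝ (Fin m)),
        (∀ m, 3 ≤ m → IsCorrelation (S m) ∧ DependenceCalib (S m) η ∧ MeanCalib (μ m) h) →
        Tendsto (fun m : ℕ => signalProp (μ m) * (m : ℝ) ^ γ) atTop (𝓝 1) →
      ∀ C₁ CHalf : ℝ → ℝ,
        (∀ a : ℝ, 0 < a → a < 1 → ∀ m, 3 ≤ m →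
          (multivariateGaussian 0 (S m)).real
            {x | boundOne (C₁ a) m < nullStat 1 Finset.univ x} < a ∧
          (multivariateGaussian 0 (S m)).real
            {x | boundHalf (CHalf a) η m < nullStat (1 / 2) Finset.univ x} < a) →
      ∀ α : ℕ → ℝ, (∀ m, 0 < α m ∧ α m < 1) → Tendsto α atTop (𝓝 0) →
        (∀ δ : ℝ, 0 < δ → ∀ᶠ m : ℕ in atTop,
          C₁ (α m) ≤ (m : ℝ) ^ δ ∧ CHalf (α m) ≤ (m : ℝ) ^ δ) →
        (max (γ - max (η - γ) 0) 0 < h →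
          ∀ ε : ℝ, 0 < ε →
            Tendsto (fun m : ℕ => (multivariateGaussian (μ m) (S m)).real
              {x | (1 - ε) * signalProp (μ m) <
                    piHat (boundHalf (CHalf (α m)) η m) (boundOne (C₁ (α m)) m) x ∧
                  piHat (boundHalf (CHalf (α m)) η m) (boundOne (C₁ (α m)) m) x <
                    signalProp (μ m)}) atTop (𝓝 1)) ∧
        (h < max (γ - max (η - γ) 0) 0 →
          (∀ ε : ℝ, 0 < ε →
            Tendsto (fun m : ℕ => (multivariateGaussian (μ m) (S m)).real
              {x | ε < |piHat (boundHalf (CHalf (α m)) η m) (boundOne (C₁ (α m)) m) x /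
                    signalProp (μ m)|}) atTop (𝓝 0)) ∧
          (∀ ε : ℝ, 0 < ε → ε < 1 →
            Tendsto (fun m : ℕ => (multivariateGaussian (μ m) (S m)).real
              {x | (1 - ε) * signalProp (μ m) <
                    piHat (boundHalf (CHalf (α m)) η m) (boundOne (C₁ (α m)) m) x ∧
                  piHat (boundHalf (CHalf (α m)) η m) (boundOne (C₁ (α m)) m) x <
                    signalProp (μ m)}) atTop (𝓝 0)))) := by
  refine ⟨fun a ha ha1 => ?_, fun a ha _ m hm S hS _ _ μ _ _ _ _ _ cHalf cOne h1 h2 h3 h4 =>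
    one_sub_le_measureReal_piHat_lt_of_nullStat hm h1 h2 h3 h4, ?_⟩
  · -- with these constants each of the four deviation probabilities is at most `a / 4`
    refine ⟨24 / a, 300 / a, by positivity, by positivity, fun C₁ CHalf h1 h2 η hη0 hη1 => ?_⟩
    have hC1 : 0 < C₁ := lt_of_lt_of_le (by positivity) h1
    have hC2 : 1 ≤ CHalf := by
      refine le_trans ?_ h2
      rw [le_div_iff₀ ha]
      linarith
    have hC2' : 0 < CHalf := by linarith
    have hb1 : 6 / C₁ ≤ a / 4 := by
      rw [div_le_iff₀ ha] at h1
      rw [div_le_iff₀ hC1]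
      linarith
    have hb2 : 75 / CHalf ^ 2 ≤ a / 4 := by
      rw [div_le_iff₀ ha] at h2
      rw [div_le_iff₀ (by positivity)]
      nlinarith [mul_le_mul_of_nonneg_left hC2 (by positivity : 0 ≤ CHalf * a)]
    refine ⟨monotone_mul_boundOne hC1.le, monotone_mul_boundHalf hC2'.le hη1,
      fun m hm S hS hη => ⟨?_, ?_, fun γ h μ _ _ _ _ _ => ?_⟩⟩
    · exact (measureReal_boundOne_lt_nullStat_le hm hS hC1).trans_lt (by linarith)
    · exact (measureReal_boundHalf_lt_nullStat_le hm hS hη hC2').trans_lt (by linarith)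
    · exact le_trans (by linarith) (one_sub_le_measureReal_piHat_lt (μ := μ) hm hS hη hC2' hC1)
  · intro γ η h hγ0 hγ1 hη0 hη1 hh S μ hS hπ C₁ CHalf hC α hα hα0 hgrowth
    have hOne : Tendsto (fun m => C₁ (α m)) atTop atTop := by
      refine tendsto_atTop.2 fun M => ?_
      filter_upwards [eventually_le_constant (θ := 1) (by norm_num) (fun m hm => (hS m hm).1)
        (bnd := boundOne) monotone_boundOne (fun M m _ _ => le_rfl)
        (fun a ha ha1 m hm => (hC a ha ha1 m hm).1) hα hα0 |M| (abs_nonneg M)] with m hm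
      exact (le_abs_self M).trans hm
    have hHalf : Tendsto (fun m => CHalf (α m)) atTop atTop := by
      refine tendsto_atTop.2 fun M => ?_
      filter_upwards [eventually_le_constant (θ := 1 / 2) le_rfl (fun m hm => (hS m hm).1)
        (bnd := fun C m => boundHalf C η m) (monotone_boundHalf η)
        (fun M m hM hm => boundHalf_le hη0 hM hm)
        (fun a ha ha1 m hm => (hC a ha ha1 m hm).2) hα hα0 |M| (abs_nonneg M)] with m hm
      exact (le_abs_self M).trans hm
    have hOneG : ∀ δ : ℝ, 0 < δ → ∀ᶠ m : ℕ in atTop, C₁ (α m) ≤ (m : ℝ) ^ δ := fun δ hδ =>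
      (hgrowth δ hδ).mono fun _ h => h.1
    have hHalfG : ∀ δ : ℝ, 0 < δ → ∀ᶠ m : ℕ in atTop, CHalf (α m) ≤ (m : ℝ) ^ δ := fun δ hδ =>
      (hgrowth δ hδ).mono fun _ h => h.2
    refine ⟨fun hth ε hε => ?_, fun hth => ?_⟩
    · have hth' : γ < h ∨ 2 * γ - η < h := by
        have h1 := (le_max_left _ _).trans_lt hth
        rcases le_total (η - γ) 0 with h2 | h2
        · rw [max_eq_right h2] at h1
          exact Or.inl (by linarith)
        · rw [max_eq_left h2] at h1
          exact Or.inr (by linarith)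
      have key := tendsto_measureReal_piHat_consistent hh hS hπ hγ1 hη0 hHalf hOne hHalfG hOneG
        hth' (lt_min hε one_pos) (min_le_right ε 1)
      refine tendsto_of_tendsto_of_tendsto_of_le_of_le key tendsto_const_nhds
        (fun m => measureReal_mono fun x hx => ⟨?_, hx.2⟩) fun m => measureReal_le_one
      refine lt_of_le_of_lt (mul_le_mul_of_nonneg_right ?_ signalProp_nonneg) hx.1
      linarith [min_le_left ε 1]
    · have hth1 : h < γ - max (η - γ) 0 := by
        rcases lt_max_iff.1 hth with h1 | h1
        · exact h1
        · linarith
      have key := fun ε (hε : 0 < ε) => tendsto_measureReal_piHat_div_large hh hS hπ hγ1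
        hHalf hOne hOneG (by linarith [le_max_right (η - γ) 0])
        (by linarith [le_max_left (η - γ) 0]) (ε := ε) hε
      refine ⟨key, fun ε _ hε1 => ?_⟩
      refine squeeze_zero' (Eventually.of_forall fun m => measureReal_nonneg) ?_
        (key ((1 - ε) / 2) (by linarith))
      filter_upwards [eventually_signalProp hπ] with m hm
      refine measureReal_mono fun x hx => ?_
      have h1 := (lt_div_iff₀ hm.2.2).2 hx.1
      exact ((by linarith : (1 - ε) / 2 < 1 - ε).trans h1).trans_le (le_abs_self _)
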